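/- Let $G=(V,E)$ be a finite simple undirected graph with edge costs $c_e\ge 0$ $(e\in E)$. For $F\subseteq E$ let $c(F)=\sum_{e\in F}c_e$ be its cost and let $$p_c(F)=\sum_{v\in V}\max\{c_e : e\in F,\ e \text{ is incident to } v\}$$ be its power, where the maximum over the empty set is $0$. In the problem Min-Power $k$ Edge-Disjoint $st$-Paths, the input consists of $G$, the costs $c$, two nodes $s,t\in V$ and an integer $k\ge 1$; a feasible solution is a set $F\subseteq E$ such that the graph $(V,F)$ contains $k$ pairwise edge-disjoint $st$-paths, and the goal is to find a feasible solution of minimum power. **Theorem.** Min-Power $k$ Edge-Disjoint $st$-Paths admits a polynomial-time $2\sqrt{2k}$-approximation algorithm. More precisely, there are a single algorithm and a polynomial $q$ such that on every input the algorithm halts after at most $q(|V|+|E|)$ steps, it reports correctly whether a feasible solution exists, and if one exists, it outputs a feasible solution $F$ whose cost $c(F)$ is minimum among all feasible solutions and which satisfies $$p_c(F)\le 2\sqrt{2k}\cdot p_c(F^*)\qquad\text{for every feasible solution } F^* .$$ Here an algorithm is a program of a random access machine, given the list of edges with their costs, which manipulates natural numbers and real numbers only by additions, subtractions and comparisons (as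 well as reading and writing memory cells and branching), each of which counts as one step; the costs may be arbitrary non-negative reals. -/

import Mathlib

open scoped NNReal

noncomputable section

/-! ### Graphs, power, edge-disjoint paths -/

namespace MinPower

variable {V : Type*}

/-- The power `p_c(F) = ∑_v max {c_e : e ∈ F incident to v}` of an edge set `F`.
The supremum of the empty set in `ℝ≥0` is `0`. -/
def power [Fintype V] [DecidableEq V] (c : Sym2 V → ℝ≥0) (F : Finset (Sym2 V)) : ℝ≥0 :=
  ∑ v : V, (F.filter (fun e => v ∈ e)).sup c

/-- `H` contains `k` pairwise edge-disjoint paths from `s` to `t`. -/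
def HasEdgeDisjointPaths (H : SimpleGraph V) (s t : V) (k : ℕ) : Prop :=
  ∃ p : Fin k → H.Path s t,
    Pairwise fun i j => List.Disjoint (p i).1.edges (p j).1.edges

/-- `F` is a feasible solution: a set of edges of `G` such that the graph `(V, F)` contains
`k` edge-disjoint paths from `s` to `t`. -/
def Feasible (G : SimpleGraph V) (s t : V) (k : ℕ) (F : Finset (Sym2 V)) : Prop :=
  (F : Set (Sym2 V)) ⊆ G.edgeSet ∧
    HasEdgeDisjointPaths (SimpleGraph.fromEdgeSet (F : Set (Sym2 V))) s t k

end MinPower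

/-! ### The machine model

Programs of a random access machine with two kinds of storage: finitely many arrays of natural
numbers and finitely many arrays of real numbers, all of them indexed by (computed) natural numbers.
Every elementary operation costs one time unit. The only arithmetic operations are addition and
subtraction, and there is no conversion from reals to natural numbers other than branching on a
comparison. In particular, after `τ` steps the real cells hold integer combinations, with
coefficients at most `2 ^ τ` in absolute value, of the reals in the input, and the natural cells
hold numbers of at most `τ` bits more than the input and the constants of the program.
Hence, on rational inputs, a polynomial number of steps is also polynomial time in the bit model. -/

namespace RAM

/-- The contents of the memory: `nat a i` is cell `i` of the array number `a` of natural numbers,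
`real b i` is cell `i` of the array number `b` of real numbers. -/
structure Store where
  nat : ℕ → ℕ → ℕ
  real : ℕ → ℕ → ℝ

/-- Overwrite one cell of an array of natural numbers. -/
def Store.setNat (σ : Store) (a i x : ℕ) : Store :=
  { σ with nat := fun a' i' => if a' = a ∧ i' = i then x else σ.nat a' i' }

/-- Overwrite one cell of an array of real numbers. -/
def Store.setReal (σ : Store) (b i : ℕ) (x : ℝ) : Store :=
  { σ with real := fun b' i' => if b' = b ∧ i' = i then x else σ.real b' i' }

/-- Expressions for natural numbers; `get a i` reads cell `i` of array `a`. -/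
inductive NatExp : Type
  | const (x : ℕ)
  | get (a : ℕ) (i : NatExp)
  | add (e₁ e₂ : NatExp)
  | sub (e₁ e₂ : NatExp)

/-- The value of an expression (subtraction is truncated at `0`). -/
def NatExp.eval (σ : Store) : NatExp → ℕ
  | const x => x
  | get a i => σ.nat a (i.eval σ)
  | add e₁ e₂ => e₁.eval σ + e₂.eval σ
  | sub e₁ e₂ => e₁.eval σ - e₂.eval σ

/-- The number of operations needed to evaluate an expression. -/
def NatExp.cost : NatExp → ℕ
  | const _ => 1
  | get _ i => 1 + i.cost
  | add e₁ e₂ => 1 + e₁.cost + e₂.cost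
  | sub e₁ e₂ => 1 + e₁.cost + e₂.cost

/-- Expressions for real numbers; `0` is the only constant. -/
inductive RealExp : Type
  | zero
  | get (b : ℕ) (i : NatExp)
  | add (e₁ e₂ : RealExp)
  | sub (e₁ e₂ : RealExp)

/-- The value of an expression. -/
def RealExp.eval (σ : Store) : RealExp → ℝ
  | zero => 0
  | get b i => σ.real b (i.eval σ)
  | add e₁ e₂ => e₁.eval σ + e₂.eval σ
  | sub e₁ e₂ => e₁.eval σ - e₂.eval σ

/-- The number of operations needed to evaluate an expression. -/
def RealExp.cost : RealExp → ℕ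
  | zero => 1
  | get _ i => 1 + i.cost
  | add e₁ e₂ => 1 + e₁.cost + e₂.cost
  | sub e₁ e₂ => 1 + e₁.cost + e₂.cost

/-- Tests, on which a program can branch. -/
inductive Test : Type
  | natLe (e₁ e₂ : NatExp)
  | realLe (e₁ e₂ : RealExp)
  | not (b : Test)
  | and (b₁ b₂ : Test)

/-- The outcome of a test. -/
def Test.holds (σ : Store) : Test → Prop
  | natLe e₁ e₂ => e₁.eval σ ≤ e₂.eval σ
  | realLe e₁ e₂ => e₁.eval σ ≤ e₂.eval σ
  | not b => ¬ b.holds σ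
  | and b₁ b₂ => b₁.holds σ ∧ b₂.holds σ

/-- The number of operations needed to evaluate a test. -/
def Test.cost : Test → ℕ
  | natLe e₁ e₂ => 1 + e₁.cost + e₂.cost
  | realLe e₁ e₂ => 1 + e₁.cost + e₂.cost
  | not b => 1 + b.cost
  | and b₁ b₂ => 1 + b₁.cost + b₂.cost

/-- Programs. -/
inductive Program : Type
  | skip
  | setNat (a : ℕ) (i e : NatExp)
  | setReal (b : ℕ) (i : NatExp) (e : RealExp)
  | seq (P Q : Program)
  | branch (b : Test) (P Q : Program)
  | loop (b : Test) (P : Program)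

/-- `Exec P σ τ σ'`: the program `P`, started on the memory `σ`, halts after exactly `τ` time units
with the memory `σ'`. (`loop b P` means: while `b` holds, do `P`.) -/
inductive Exec : Program → Store → ℕ → Store → Prop
  | skip (σ : Store) : Exec .skip σ 1 σ
  | setNat (a : ℕ) (i e : NatExp) (σ : Store) :
      Exec (.setNat a i e) σ (1 + i.cost + e.cost) (σ.setNat a (i.eval σ) (e.eval σ))
  | setReal (b : ℕ) (i : NatExp) (e : RealExp) (σ : Store) :
      Exec (.setReal b i e) σ (1 + i.cost + e.cost) (σ.setReal b (i.eval σ) (e.eval σ))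
  | seq {P Q : Program} {σ₁ σ₂ σ₃ : Store} {τ₁ τ₂ : ℕ} :
      Exec P σ₁ τ₁ σ₂ → Exec Q σ₂ τ₂ σ₃ → Exec (.seq P Q) σ₁ (τ₁ + τ₂) σ₃
  | branch_true {b : Test} {P Q : Program} {σ σ' : Store} {τ : ℕ} :
      b.holds σ → Exec P σ τ σ' → Exec (.branch b P Q) σ (1 + b.cost + τ) σ'
  | branch_false {b : Test} {P Q : Program} {σ σ' : Store} {τ : ℕ} :
      ¬ b.holds σ → Exec Q σ τ σ' → Exec (.branch b P Q) σ (1 + b.cost + τ) σ'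
  | loop_true {b : Test} {P : Program} {σ₁ σ₂ σ₃ : Store} {τ₁ τ₂ : ℕ} :
      b.holds σ₁ → Exec P σ₁ τ₁ σ₂ → Exec (.loop b P) σ₂ τ₂ σ₃ →
        Exec (.loop b P) σ₁ (1 + b.cost + τ₁ + τ₂) σ₃
  | loop_false {b : Test} {P : Program} {σ : Store} :
      ¬ b.holds σ → Exec (.loop b P) σ (1 + b.cost) σ

end RAM

/-! ### Input and output of an algorithm for Min-Power `k` Edge-Disjoint `st`-Paths -/

namespace MinPower

/-- `l` lists every edge of `G` exactly once, each by its two ends in some order. -/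
def IsEdgeList {V : Type*} (G : SimpleGraph V) (l : List (V × V)) : Prop :=
  (l.map fun x => s(x.1, x.2)).Nodup ∧
    ∀ e : Sym2 V, e ∈ G.edgeSet ↔ e ∈ l.map fun x => s(x.1, x.2)

/-- The memory that holds the input: array `0` of natural numbers starts with the number of nodes,
the number of edges, `s`, `t` and `k`; the arrays `1` and `2` of natural numbers hold the two ends
of the listed edges and the array `0` of real numbers holds their costs. All other cells
are `0`. -/
def inputStore {n : ℕ} (l : List (Fin n × Fin n)) (c : Sym2 (Fin n) → ℝ≥0)
    (s t : Fin n) (k : ℕ) : RAM.Store where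
  nat a i :=
    match a with
    | 0 => [n, l.length, (s : ℕ), (t : ℕ), k].getD i 0
    | 1 => (l.map fun x => (x.1 : ℕ)).getD i 0
    | 2 => (l.map fun x => (x.2 : ℕ)).getD i 0
    | _ => 0
  real b i :=
    match b with
    | 0 => (l.map fun x => (c s(x.1, x.2) : ℝ)).getD i 0
    | _ => 0

/-- The edge set that is read off the final memory: the `i`-th listed edge is selected if and only
if cell `i` of array `3` of natural numbers is not `0`. -/
def outputEdges {n : ℕ} (l : List (Fin n × Fin n)) (σ : RAM.Store) : Finset (Sym2 (Fin n)) :=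
  (Finset.univ.filter fun i : Fin l.length => σ.nat 3 i ≠ 0).image
    fun i => s((l.get i).1, (l.get i).2)

/-- The final memory reports a solution if cell `0` of array `4` of natural numbers is not `0`;
otherwise it reports that there is no feasible solution. -/
def ReportsSolution (σ : RAM.Store) : Prop := σ.nat 4 0 ≠ 0

end MinPower

end

noncomputable section

/-! The algorithm computes a minimum-cost solution `F`, by minimum-cost flow with unit capacities. A
maximum is at most a sum and an edge has two ends, so the power of `F` is at most `2 c(F)`
(`power_le_two_mul_sum`). It remains to find, inside an arbitrary solution `F*`, a solution `F'`
with `c(F') ≤ √(2k) p(F*)` (`Feasible.exists_sum_le_sqrt_mul_power`); then `p(F) ≤ 2 c(F) ≤ 2 c(F')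
≤ 2√(2k) p(F*)`.

For `F'` take the support of a `k`-flow in `(V, F*)` with the fewest edges. Optimal potentials for
unit costs rise by at least `1` along each flow arc (`Slack`). Hence no flow arc crosses a level of
the potential downwards, and at most `k` arcs cross any level. This forces sparsity: at most `√(2k)
|U|` arcs lie inside any node set `U` (`card_sq_le_of_crossing_le`). The cost of an edge is at most
the smaller of the powers of its two ends in `F*`, and peeling these powers off layer by layer turns
the density bound into the cost bound (`sum_min_le_of_card_le`).

The flow is found by successive augmentation along residual arcs of reduced cost `0`, with
Dijkstra-like updates of the potentials. The edge states stay integral, so no rounding is needed,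
and the final potentials certify optimality (`IsFlow.cost_le`). If the search fails, the reached
nodes form a saturated cut (`IsFlow.le_of_cut`). There are at most `|E|` successful augmentations,
so the time does not depend on `k`. The verified program also serves as an existence proof: run on
`(V, F*)` with unit costs, it yields the potentials used above. -/

namespace MinPower

/-! ### Unit-capacity flows: duality and cuts. -/

section Flow

variable {ι V : Type*} [Fintype ι] [DecidableEq V]

/-- The amount of the signed flow `y` that leaves the node `v`, where `y i` units run from `a i`
to `b i`. -/
def netOut (a b : ι → V) (y : ι → ℤ) (v : V) : ℤ :=
  ∑ i, y i * ((if a i = v then 1 else 0) - (if b i = v then 1 else 0))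

/-- `y` is a flow of value `k` from `s` to `t` that uses every edge at most once. -/
structure IsFlow (a b : ι → V) (s t : V) (k : ℤ) (y : ι → ℤ) : Prop where
  abs_le : ∀ i, |y i| ≤ 1
  netOut_eq : ∀ v, netOut a b y v = k * ((if v = s then 1 else 0) - (if v = t then 1 else 0))

/-- The complementary slackness conditions for a flow `y`, edge costs `c` and node
potentials `π`. -/
def Slack (a b : ι → V) (c : ι → ℝ) (y : ι → ℤ) (π : V → ℝ) : Prop :=
  ∀ i, (y i = 0 → |π (b i) - π (a i)| ≤ c i) ∧ (y i = 1 → c i ≤ π (b i) - π (a i)) ∧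
    (y i = -1 → c i ≤ π (a i) - π (b i))

lemma IsFlow.cases {a b : ι → V} {s t : V} {k : ℤ} {y : ι → ℤ} (h : IsFlow a b s t k y) (i : ι) :
    y i = 0 ∨ y i = 1 ∨ y i = -1 := by
  have := _root_.abs_le.1 (h.abs_le i); omega

/-- Summation by parts: a node function paired with the divergence equals its differences along the
edges paired with the flow. -/
lemma sum_mul_netOut {R : Type*} [CommRing R] [Fintype V] (a b : ι → V) (y : ι → ℤ) (f : V → R) :
    ∑ v, f v * (netOut a b y v : R) = ∑ i, (y i : R) * (f (a i) - f (b i)) := by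
  simp only [netOut, Int.cast_sum, Finset.mul_sum]
  rw [Finset.sum_comm]
  refine Finset.sum_congr rfl fun i _ => ?_
  have h (w : V) : ∑ v, f v * (if w = v then (1 : R) else 0) = f w := by simp
  rw [← h (a i), ← h (b i), ← Finset.sum_sub_distrib, Finset.mul_sum]
  refine Finset.sum_congr rfl fun v _ => ?_
  push_cast
  ring

/-- With `f` a potential this compares costs of flows; with `f` the indicator of a node set it
computes the flow across a cut. -/
lemma IsFlow.sum_eq {R : Type*} [CommRing R] [Fintype V] {a b : ι → V} {s t : V} {k : ℤ}
    {y : ι → ℤ} (h : IsFlow a b s t k y) (f : V → R) :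
    ∑ i, (y i : R) * (f (a i) - f (b i)) = k * (f s - f t) := by
  rw [← sum_mul_netOut]
  simp only [h.netOut_eq]
  have h (w : V) : ∑ v, f v * (if v = w then (1 : R) else 0) = f w := by simp
  rw [← h s, ← h t, ← Finset.sum_sub_distrib, Finset.mul_sum]
  refine Finset.sum_congr rfl fun v _ => ?_
  push_cast
  ring

/-- A flow that satisfies complementary slackness has minimum cost. -/
lemma IsFlow.cost_le [Fintype V] {a b : ι → V} {s t : V} {k : ℤ} {y z : ι → ℤ} {c : ι → ℝ}
    {π : V → ℝ} (hc : ∀ i, 0 ≤ c i) (hy : IsFlow a b s t k y) (hs : Slack a b c y π) (hz : IsFlow a b s t k z) :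
    ∑ i, c i * |(y i : ℝ)| ≤ ∑ i, c i * |(z i : ℝ)| := by
  -- Edge by edge, slackness says that `y i` minimizes the Lagrangian `c i * |x| + x * (π (a i) - π
  -- (b i))` over `x ∈ {-1, 0, 1}`. The potential terms add up to the same constant for both flows.
  have key : ∑ i, (c i * |(y i : ℝ)| + y i * (π (a i) - π (b i))) ≤
      ∑ i, (c i * |(z i : ℝ)| + z i * (π (a i) - π (b i))) := by
    refine Finset.sum_le_sum fun i _ => ?_
    obtain ⟨h0, h1, h2⟩ := hs i
    have := hc i
    rcases hy.cases i with h | h | h <;> rcases hz.cases i with h' | h' | h' <;>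
      simp only [h, h', true_implies] at h0 h1 h2 ⊢ <;> norm_num <;>
      first | linarith [(_root_.abs_le.1 h0).1, (_root_.abs_le.1 h0).2] | linarith
  rw [Finset.sum_add_distrib, Finset.sum_add_distrib, hy.sum_eq, hz.sum_eq] at key
  linarith

/-- A flow that saturates a cut has maximum value. -/
lemma IsFlow.le_of_cut [Fintype V] {a b : ι → V} {s t : V} {j k : ℤ} {y z : ι → ℤ}
    (hy : IsFlow a b s t j y) (hz : IsFlow a b s t k z) (S : V → Prop) (hs : S s) (ht : ¬ S t)
    (hab : ∀ i, S (a i) → ¬ S (b i) → y i = 1) (hba : ∀ i, S (b i) → ¬ S (a i) → y i = -1) :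
    k ≤ j := by
  classical
  -- Paired with the indicator of `S`, each flow value becomes a sum over the cut edges, where `y`
  -- is termwise as large as possible.
  have h1 := hy.sum_eq (R := ℤ) (fun v => if S v then 1 else 0)
  have h2 := hz.sum_eq (R := ℤ) (fun v => if S v then 1 else 0)
  simp only [hs, ht, if_true, if_false, Int.cast_id, sub_zero, mul_one] at h1 h2
  rw [← h1, ← h2]
  refine Finset.sum_le_sum fun i _ => ?_
  have := hab i; have := hba i
  by_cases ha : S (a i) <;> by_cases hb : S (b i) <;> simp_all <;>
    rcases hz.cases i with h | h | h <;> omega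

lemma IsFlow.value_le_card {a b : ι → V} {s t : V} {k : ℤ} {y : ι → ℤ} (hst : s ≠ t)
    (h : IsFlow a b s t k y) : k ≤ Fintype.card ι := by
  have h1 := h.netOut_eq s
  simp only [if_true, hst, if_false, sub_zero, mul_one] at h1
  rw [← h1, netOut, ← Finset.card_univ, Finset.card_eq_sum_ones, Nat.cast_sum]
  refine Finset.sum_le_sum fun i _ => ?_
  rcases h.cases i with h | h | h <;> rw [h] <;> split_ifs <;> simp

end Flow

/-! ### Sparsity of arc sets with few level crossings. -/

section Density

variable {ι V : Type*}

/-- A set of arcs that go up along `f`, no two of them parallel, at most `k` of which cross any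
level of `f`, has at most `√(2k) |U|` arcs inside any set `U` of nodes. -/
lemma card_sq_le_of_crossing_le [DecidableEq V] (D : Finset ι) (x y : ι → V) (f : V → ℝ) (k : ℕ)
    (U : Finset V) (hU : ∀ i ∈ D, x i ∈ U ∧ y i ∈ U)
    (hinj : ∀ i ∈ D, ∀ j ∈ D, x i = x j → y i = y j → i = j) (hf : ∀ i ∈ D, f (x i) < f (y i))
    (hk : ∀ r, (D.filter fun i => f (x i) < r ∧ r ≤ f (y i)).card ≤ k) :
    D.card ^ 2 ≤ 2 * k * U.card ^ 2 := by
  classical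
  set out : V → Finset ι := fun u => D.filter fun i => x i = u
  have hcard : D.card = ∑ u ∈ U, (out u).card :=
    Finset.card_eq_sum_card_fiberwise fun i hi => (hU i hi).1
  -- Arcs out of `u` have distinct heads, so the arcs no longer than `i` are counted by nodes whose
  -- level is crossed by `i`.
  have hlen : ∀ u ∈ U, ∀ i ∈ out u, ((out u).filter fun j => f (y j) ≤ f (y i)).card ≤
      (U.filter fun w => f u < f w ∧ f w ≤ f (y i)).card := by
    intro u _ i _
    refine Finset.card_le_card_of_injOn y ?_ ?_
    · intro j hj
      simp only [out, Finset.coe_filter, Finset.mem_filter, Set.mem_ofPred_eq] at hj ⊢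
      exact ⟨(hU j hj.1.1).2, hj.1.2 ▸ hf j hj.1.1, hj.2⟩
    · intro j hj j' hj' h
      simp only [out, Finset.coe_filter, Finset.mem_filter, Set.mem_ofPred_eq] at hj hj'
      exact hinj j hj.1.1 j' hj'.1.1 (hj.1.2.trans hj'.1.2.symm) h
  -- Of two arcs out of `u`, one has a head at most as high as the other's, so every ordered pair is
  -- counted by the sum or by its transpose.
  have hsq : ∀ u, (out u).card ^ 2 ≤
      2 * ∑ i ∈ out u, ((out u).filter fun j => f (y j) ≤ f (y i)).card := by
    intro u
    have h1 : ∑ i ∈ out u, ((out u).filter fun j => f (y j) ≤ f (y i)).card =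
        ∑ i ∈ out u, ((out u).filter fun j => f (y i) ≤ f (y j)).card := by
      simp only [Finset.card_filter]
      exact Finset.sum_comm
    rw [two_mul]
    nth_rw 2 [h1]
    rw [← Finset.sum_add_distrib, sq, ← smul_eq_mul, ← Finset.sum_const]
    refine Finset.sum_le_sum fun i _ => ?_
    refine le_trans (Finset.card_le_card ?_) (Finset.card_union_le _ _)
    intro j hj
    rcases le_total (f (y j)) (f (y i)) with h | h <;> simp [hj, h]
  -- Double counting of pairs of an arc and a node level that it crosses; grouped by the node, each
  -- level contributes at most `k`.
  have hswap : ∑ u ∈ U, ∑ i ∈ out u, (U.filter fun w => f u < f w ∧ f w ≤ f (y i)).card =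
      ∑ w ∈ U, (D.filter fun i => f (x i) < f w ∧ f w ≤ f (y i)).card := by
    have : ∑ u ∈ U, ∑ i ∈ out u, (U.filter fun w => f u < f w ∧ f w ≤ f (y i)).card =
        ∑ u ∈ U, ∑ i ∈ out u, (U.filter fun w => f (x i) < f w ∧ f w ≤ f (y i)).card := by
      refine Finset.sum_congr rfl fun u _ => Finset.sum_congr rfl fun i hi => ?_
      rw [(Finset.mem_filter.1 hi).2]
    rw [this, Finset.sum_fiberwise_of_maps_to fun i hi => (hU i hi).1]
    simp only [Finset.card_filter]
    exact Finset.sum_comm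
  calc D.card ^ 2 = (∑ u ∈ U, (out u).card) ^ 2 := by rw [hcard]
    _ ≤ U.card * ∑ u ∈ U, (out u).card ^ 2 := sq_sum_le_card_mul_sum_sq
    _ ≤ U.card * ∑ u ∈ U, 2 * ∑ i ∈ out u,
          (U.filter fun w => f u < f w ∧ f w ≤ f (y i)).card := by
        gcongr with u hu
        refine (hsq u).trans ?_
        gcongr with i hi
        exact hlen u hu i hi
    _ = U.card * (2 * ∑ w ∈ U, (D.filter fun i => f (x i) < f w ∧ f w ≤ f (y i)).card) := by
        rw [← Finset.mul_sum, hswap]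
    _ ≤ U.card * (2 * ∑ w ∈ U, k) := by
        gcongr with w
        exact hk _
    _ = 2 * k * U.card ^ 2 := by simp; ring

/-- A density bound for all induced subgraphs gives a bound for weights
`min {p u, p v}` on the arcs `uv`. -/
lemma sum_min_le_of_card_le [Fintype V] [DecidableEq V] (D : Finset ι) (x y : ι → V) (K : ℝ)
    (hK : ∀ U : Finset V, ((D.filter fun i => x i ∈ U ∧ y i ∈ U).card : ℝ) ≤ K * U.card)
    (p : V → ℝ) (hp : ∀ v, 0 ≤ p v) :
    ∑ i ∈ D, min (p (x i)) (p (y i)) ≤ K * ∑ v, p v := by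
  -- Layer-cake argument: subtract the least positive value `p w` on the support `U` of `p`, which
  -- shrinks the support, and apply the density bound to `U`.
  induction' hN : (Finset.univ.filter fun v => p v ≠ 0).card using Nat.strong_induction_on
    with N ih generalizing p
  set U := Finset.univ.filter fun v => p v ≠ 0 with hU
  rcases U.eq_empty_or_nonempty with h0 | hne
  · have h : ∀ v, p v = 0 := by
      intro v
      by_contra h
      have : v ∈ U := by simp [hU, h]
      simp [h0] at this
    simp [h]
  obtain ⟨w, hw, hmin⟩ := U.exists_min_image p hne
  have hmem : ∀ v, v ∈ U ↔ p v ≠ 0 := by simp [hU]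
  set q : V → ℝ := fun v => p v - if v ∈ U then p w else 0 with hq
  have hq0 : ∀ v, 0 ≤ q v := by
    intro v
    by_cases hv : v ∈ U
    · simpa [hq, hv] using hmin v hv
    · simpa [hq, hv] using hp v
  have hlt : (Finset.univ.filter fun v => q v ≠ 0).card < N := by
    rw [← hN]
    refine Finset.card_lt_card ((Finset.ssubset_iff_of_subset ?_).2 ⟨w, hw, by simp [hq, hw]⟩)
    intro v hv
    rw [hmem]
    intro h
    have : v ∉ U := by rw [hmem]; simp [h]
    simp [hq, this, h] at hv
  have hrec := ih _ hlt q hq0 rfl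
  have hsum : ∑ v, p v = ∑ v, q v + U.card * p w := by
    simp only [hq, Finset.sum_sub_distrib, Finset.sum_ite_mem, Finset.univ_inter,
      Finset.sum_const, nsmul_eq_mul]
    ring
  -- The minimum drops by `p w` on arcs inside `U`; on all other arcs it is `0` before and after.
  have hminsum : ∑ i ∈ D, min (p (x i)) (p (y i)) = ∑ i ∈ D, min (q (x i)) (q (y i)) +
      (D.filter fun i => x i ∈ U ∧ y i ∈ U).card * p w := by
    rw [← nsmul_eq_mul, ← Finset.sum_const, Finset.sum_filter, ← Finset.sum_add_distrib]
    refine Finset.sum_congr rfl fun i _ => ?_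
    by_cases h1 : x i ∈ U <;> by_cases h2 : y i ∈ U
    · simp [hq, h1, h2, min_sub_sub_right]
    · have : p (y i) = 0 := by simpa [hmem] using h2
      simp [hq, h1, h2, this, hp, hmin _ h1]
    · have : p (x i) = 0 := by simpa [hmem] using h1
      simp [hq, h1, h2, this, hp, hmin _ h2]
    · simp [hq, h1, h2]
  rw [hminsum, hsum, mul_add, ← mul_assoc]
  have := hK U
  have := hp w
  gcongr

end Density

/-! ### Edge-disjoint paths versus integral flows. -/

section Paths

variable {ι V : Type*} [DecidableEq V] {H : SimpleGraph V} {a b : ι → V}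

/-- The unit flow along a walk. -/
def walkFlow (a b : ι → V) : {u v : V} → H.Walk u v → ι → ℤ
  | _, _, .nil => fun _ => 0
  | _, _, .cons (u := u) (v := v) _ p => fun i =>
    ((if a i = u ∧ b i = v then 1 else 0) - if b i = u ∧ a i = v then 1 else 0) +
      walkFlow a b p i

/-- Each traversal of an edge contributes at most one unit; for disjoint paths this becomes the
capacity constraint. -/
lemma abs_walkFlow_le {u v : V} (p : H.Walk u v) (i : ι) :
    |walkFlow a b p i| ≤ p.edges.count s(a i, b i) := by
  induction p with
  | nil => simp [walkFlow]
  | @cons u v w h p ih =>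
    rw [walkFlow, SimpleGraph.Walk.edges_cons, List.count_cons, Nat.cast_add]
    refine (abs_add_le _ _).trans ((add_comm _ _).trans_le (add_le_add ih ?_))
    by_cases h1 : a i = u ∧ b i = v <;> by_cases h2 : b i = u ∧ a i = v <;>
      simp [h1, h2, Sym2.eq_swap] <;> split_ifs <;> simp

lemma netOut_walkFlow [Fintype ι] (hinj : Function.Injective fun i => s(a i, b i))
    {u v : V} (p : H.Walk u v) (hp : ∀ e ∈ p.edges, ∃ i, s(a i, b i) = e) (w : V) :
    netOut a b (walkFlow a b p) w = (if w = u then 1 else 0) - if w = v then 1 else 0 := by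
  induction p with
  | nil => simp [netOut, walkFlow]
  | @cons u v x h p ih =>
    rw [SimpleGraph.Walk.edges_cons, List.forall_mem_cons] at hp
    obtain ⟨j, hj⟩ := hp.1
    have hne : u ≠ v := h.ne
    have h1 : netOut a b (fun i => (if a i = u ∧ b i = v then 1 else 0) -
        if b i = u ∧ a i = v then 1 else 0) w =
        (if w = u then 1 else 0) - if w = v then 1 else 0 := by
      -- By injectivity exactly one index `j` represents the first edge of the walk.
      rw [netOut, Finset.sum_eq_single j]
      · rcases Sym2.eq_iff.1 hj with ⟨h1, h2⟩ | ⟨h1, h2⟩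
        · simp [h1, h2, hne.symm, eq_comm]
        · simp [h1, h2, hne.symm, eq_comm]
      · intro i _ hi
        have h1 : ¬ (a i = u ∧ b i = v) := fun h => hi (hinj (by simp [h, hj]))
        have h2 : ¬ (b i = u ∧ a i = v) := fun h => hi (hinj (by simp [h, hj, Sym2.eq_swap]))
        simp [h1, h2]
      · simp
    have h2 : netOut a b (walkFlow a b (.cons h p)) w =
        netOut a b (fun i => (if a i = u ∧ b i = v then 1 else 0) -
          if b i = u ∧ a i = v then 1 else 0) w + netOut a b (walkFlow a b p) w := by
      simp only [netOut, walkFlow, add_mul, Finset.sum_add_distrib]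
    rw [h2, h1, ih hp.2]
    ring

/-- Edge-disjoint paths give a flow. -/
lemma HasEdgeDisjointPaths.exists_isFlow [Fintype ι]
    (hinj : Function.Injective fun i => s(a i, b i))
    (hH : ∀ e ∈ H.edgeSet, ∃ i, s(a i, b i) = e) {s t : V} {k : ℕ}
    (h : HasEdgeDisjointPaths H s t k) :
    ∃ y : ι → ℤ, IsFlow a b s t k y ∧ ∀ i, y i ≠ 0 → s(a i, b i) ∈ H.edgeSet := by
  obtain ⟨p, hp⟩ := h
  have hzero : ∀ i j, s(a i, b i) ∉ (p j).1.edges → walkFlow a b (p j).1 i = 0 := by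
    intro i j hij
    have := abs_walkFlow_le (a := a) (b := b) (p j).1 i
    rw [List.count_eq_zero_of_not_mem hij] at this
    exact abs_nonpos_iff.1 this
  refine ⟨fun i => ∑ j, walkFlow a b (p j).1 i, ⟨fun i => ?_, fun v => ?_⟩, fun i hi => ?_⟩
  · by_cases h : ∃ j, s(a i, b i) ∈ (p j).1.edges
    · obtain ⟨j, hj⟩ := h
      rw [Finset.sum_eq_single j]
      · refine (abs_walkFlow_le _ _).trans ?_
        exact_mod_cast List.nodup_iff_count_le_one.1 (p j).2.isTrail.edges_nodup _
      · intro j' _ hne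
        exact hzero _ _ fun h => hp hne h hj
      · simp
    · push Not at h
      simp [hzero _ _ (h _)]
  · have : netOut a b (fun i => ∑ j, walkFlow a b (p j).1 i) v =
        ∑ j, netOut a b (walkFlow a b (p j).1) v := by
      simp only [netOut, Finset.sum_mul]
      exact Finset.sum_comm
    rw [this, Finset.sum_congr rfl fun j _ => netOut_walkFlow hinj (p j).1
      (fun e he => hH e ((p j).1.edges_subset_edgeSet he)) v]
    simp [mul_sub]
  · obtain ⟨j, -, hj⟩ := Finset.exists_ne_zero_of_sum_ne_zero hi
    by_contra h
    exact hj (hzero _ _ fun h' => h ((p j).1.edges_subset_edgeSet h'))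

/-- `u v` is an arc of the support of the flow `y`, directed as the flow. -/
def FlowArc (a b : ι → V) (y : ι → ℤ) (u v : V) : Prop :=
  ∃ i, (y i = 1 ∧ a i = u ∧ b i = v) ∨ (y i = -1 ∧ b i = u ∧ a i = v)

/-- A trail that follows the flow agrees with `y` on its own edges, so subtracting it clears exactly
these edges. -/
lemma walkFlow_eq_of_flowArc (hinj : Function.Injective fun i => s(a i, b i)) {y : ι → ℤ}
    {u v : V} (p : H.Walk u v) (hp : p.edges.Nodup)
    (hd : ∀ d ∈ p.darts, FlowArc a b y d.fst d.snd) (i : ι) :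
    walkFlow a b p i = if s(a i, b i) ∈ p.edges then y i else 0 := by
  induction p with
  | nil => simp [walkFlow]
  | @cons u v x h p ih =>
    rw [SimpleGraph.Walk.edges_cons, List.nodup_cons] at hp
    simp only [SimpleGraph.Walk.darts_cons, List.mem_cons, forall_eq_or_imp] at hd
    rw [walkFlow, SimpleGraph.Walk.edges_cons]
    beta_reduce
    rw [ih hp.2 hd.2]
    obtain ⟨j, hj⟩ := hd.1
    have hne : u ≠ v := h.ne
    by_cases hi : i = j
    · subst hi
      rcases hj with ⟨h1, rfl, rfl⟩ | ⟨h1, rfl, rfl⟩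
      · simp [hp.1, h1, hne.symm]
      · have := hp.1
        rw [Sym2.eq_swap] at this
        simp [this, h1, hne.symm, Sym2.eq_swap]
    · have h1 : ¬ (a i = u ∧ b i = v) := by
        rintro ⟨rfl, rfl⟩
        refine hi (hinj ?_)
        rcases hj with ⟨-, h1, h2⟩ | ⟨-, h1, h2⟩ <;> simp [h1, h2, Sym2.eq_swap]
      have h2 : ¬ (b i = u ∧ a i = v) := by
        rintro ⟨rfl, rfl⟩
        refine hi (hinj ?_)
        rcases hj with ⟨-, h1, h2⟩ | ⟨-, h1, h2⟩ <;> simp [h1, h2, Sym2.eq_swap]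
      have h3 : s(a i, b i) ≠ s(u, v) := by
        rw [Ne, Sym2.eq_iff]
        tauto
      simp [h1, h2, h3]

/-- Otherwise the set reachable from `s` is a cut that no flow arc leaves, so the net flow across it
is at most `0`, but it equals `k`. -/
lemma IsFlow.reflTransGen_flowArc [Fintype ι] [Fintype V] {s t : V} {k : ℤ} {y : ι → ℤ}
    (h : IsFlow a b s t k y) (hk : 0 < k) : Relation.ReflTransGen (FlowArc a b y) s t := by
  classical
  by_contra hst
  have h1 := h.sum_eq (R := ℤ) fun v => if Relation.ReflTransGen (FlowArc a b y) s v then 1 else 0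
  rw [if_pos .refl, if_neg hst] at h1
  have h2 : ∑ i, (y i : ℤ) * ((if Relation.ReflTransGen (FlowArc a b y) s (a i) then 1 else 0) -
      if Relation.ReflTransGen (FlowArc a b y) s (b i) then 1 else 0) ≤ 0 := by
    refine Finset.sum_nonpos fun i _ => ?_
    rcases h.cases i with hi | hi | hi
    · simp [hi]
    · by_cases ha : Relation.ReflTransGen (FlowArc a b y) s (a i)
      · have hb := ha.tail (c := b i) ⟨i, Or.inl ⟨hi, rfl, rfl⟩⟩
        simp [ha, hb]
      · rw [hi, if_neg ha]; split_ifs <;> simp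
    · by_cases hb : Relation.ReflTransGen (FlowArc a b y) s (b i)
      · have ha := hb.tail (c := a i) ⟨i, Or.inr ⟨hi, rfl, rfl⟩⟩
        simp [ha, hb]
      · rw [hi, if_neg hb]; split_ifs <;> simp
  simp only [Int.cast_id] at h1
  omega

lemma exists_walk_of_reflTransGen {V : Type*} {H : SimpleGraph V} {r : V → V → Prop} (hr : ∀ u v, r u v → H.Adj u v) {s t : V}
    (h : Relation.ReflTransGen r s t) : ∃ p : H.Walk s t, ∀ d ∈ p.darts, r d.fst d.snd := by
  induction h using Relation.ReflTransGen.head_induction_on with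
  | refl => exact ⟨.nil, by simp⟩
  | head h _ ih =>
    obtain ⟨p, hp⟩ := ih
    exact ⟨.cons (hr _ _ h) p, by simpa using ⟨h, hp⟩⟩

/-- A flow contains as many edge-disjoint paths as its value says. -/
lemma IsFlow.exists_paths [Fintype ι] [Fintype V]
    (hinj : Function.Injective fun i => s(a i, b i)) {s t : V} {k : ℕ} {y : ι → ℤ}
    (h : IsFlow a b s t k y) (hH : ∀ i, y i ≠ 0 → H.Adj (a i) (b i)) :
    ∃ p : Fin k → H.Path s t, (Pairwise fun i j => List.Disjoint (p i).1.edges (p j).1.edges) ∧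
      ∀ j, ∀ e ∈ (p j).1.edges, ∃ i, y i ≠ 0 ∧ s(a i, b i) = e := by
  induction k generalizing y with
  | zero => exact ⟨Fin.elim0, fun i => i.elim0, fun i => i.elim0⟩
  | succ k ih =>
    obtain ⟨p, hp⟩ := exists_walk_of_reflTransGen (H := H) (r := FlowArc a b y) (by
      rintro u v ⟨i, ⟨hi, rfl, rfl⟩ | ⟨hi, rfl, rfl⟩⟩
      · exact hH i (by simp [hi])
      · exact (hH i (by simp [hi])).symm) (h.reflTransGen_flowArc (by positivity))
    set q : H.Path s t := p.toPath with hq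
    have hqd : ∀ d ∈ q.1.darts, FlowArc a b y d.fst d.snd :=
      fun d hd => hp d (p.darts_toPath_subset_darts hd)
    have hqe : ∀ e ∈ q.1.edges, ∃ i, y i ≠ 0 ∧ s(a i, b i) = e := by
      intro e he
      obtain ⟨d, hd, rfl⟩ := List.mem_map.1 he
      obtain ⟨i, ⟨hi, h1, h2⟩ | ⟨hi, h1, h2⟩⟩ := hqd d hd
      · exact ⟨i, by simp [hi], by rw [h1, h2]; rfl⟩
      · exact ⟨i, by simp [hi], by rw [h1, h2, Sym2.eq_swap]; rfl⟩
    have hw := walkFlow_eq_of_flowArc hinj q.1 q.2.isTrail.edges_nodup hqd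
    have hnet := netOut_walkFlow hinj q.1 fun e he => (hqe e he).imp fun _ h => h.2
    -- Removing one path leaves a flow of value `k` whose support avoids the edges of the path; this
    -- gives disjointness in the recursion.
    have hy' : IsFlow a b s t k (fun i => y i - walkFlow a b q.1 i) := by
      refine ⟨fun i => ?_, fun v => ?_⟩
      · rw [hw]
        split_ifs
        · simp
        · simpa using h.abs_le i
      · have h1 : netOut a b (fun i => y i - walkFlow a b q.1 i) v =
            netOut a b y v - netOut a b (walkFlow a b q.1) v := by
          simp only [netOut, sub_mul, Finset.sum_sub_distrib]
        rw [h1, hnet, h.netOut_eq]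
        push_cast
        ring
    have hsupp : ∀ i, y i - walkFlow a b q.1 i ≠ 0 → y i ≠ 0 ∧ s(a i, b i) ∉ q.1.edges := by
      intro i hi
      rw [hw] at hi
      split_ifs at hi with h'
      · simp at hi
      · exact ⟨by simpa using hi, h'⟩
    obtain ⟨p', hp', hpe⟩ := ih hy' fun i hi => hH i (hsupp i hi).1
    have hdisj : ∀ j, List.Disjoint (p' j).1.edges q.1.edges := by
      intro j e he he'
      obtain ⟨i, hi, rfl⟩ := hpe j e he
      exact (hsupp i hi).2 he'
    refine ⟨Fin.cons q p', ?_, ?_⟩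
    · intro i j hij
      induction i using Fin.cases with
      | zero =>
        induction j using Fin.cases with
        | zero => exact absurd rfl hij
        | succ j => simpa using (hdisj j).symm
      | succ i =>
        induction j using Fin.cases with
        | zero => simpa using hdisj i
        | succ j => simpa using hp' fun h => hij (by rw [h])
    · intro j
      induction j using Fin.cases with
      | zero => simpa using hqe
      | succ j =>
        intro e he
        obtain ⟨i, hi, h⟩ := hpe j e (by simpa using he)
        exact ⟨i, (hsupp i hi).1, h⟩

end Paths

end MinPower

namespace RAM

/-! ### A program logic for termination in polynomial time -/

/-- A bound for the running time of a program in which no loop is iterated more than `X` times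
in a row. -/
def Program.timePoly : Program → Polynomial ℕ
  | skip => 1
  | setNat _ i e => Polynomial.C (1 + i.cost + e.cost)
  | setReal _ i e => Polynomial.C (1 + i.cost + e.cost)
  | seq P Q => P.timePoly + Q.timePoly
  | branch b P Q => Polynomial.C (1 + b.cost) + P.timePoly + Q.timePoly
  | loop b P => (Polynomial.X + 1) * (Polynomial.C (1 + b.cost) + P.timePoly)

/-- Started on `σ`, the program halts within the time that `timePoly` allows for loops of at most
`N` iterations, with a memory that satisfies `Q`. -/
def Runs (N : ℕ) (P : Program) (σ : Store) (Q : Store → Prop) : Prop :=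
  ∃ τ σ', Exec P σ τ σ' ∧ τ ≤ P.timePoly.eval N ∧ Q σ'

namespace Runs

variable {N : ℕ} {P R : Program} {σ : Store} {Q Q' : Store → Prop} {b : Test}

lemma mono (h : Runs N P σ Q) (hQ : ∀ σ', Q σ' → Q' σ') : Runs N P σ Q' := by
  obtain ⟨τ, σ', h1, h2, h3⟩ := h
  exact ⟨τ, σ', h1, h2, hQ _ h3⟩

lemma skip (h : Q σ) : Runs N .skip σ Q := ⟨_, _, .skip σ, by simp [Program.timePoly], h⟩

lemma setNat {a : ℕ} {i e : NatExp} (h : Q (σ.setNat a (i.eval σ) (e.eval σ))) :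
    Runs N (.setNat a i e) σ Q := ⟨_, _, .setNat a i e σ, by simp [Program.timePoly], h⟩

lemma setReal {a : ℕ} {i : NatExp} {e : RealExp} (h : Q (σ.setReal a (i.eval σ) (e.eval σ))) :
    Runs N (.setReal a i e) σ Q := ⟨_, _, .setReal a i e σ, by simp [Program.timePoly], h⟩

lemma seq (h : Runs N P σ fun σ' => Runs N R σ' Q) : Runs N (.seq P R) σ Q := by
  obtain ⟨τ₁, σ₁, h1, h2, τ₂, σ₂, h3, h4, h5⟩ := h
  exact ⟨_, _, .seq h1 h3, by simpa [Program.timePoly] using add_le_add h2 h4, h5⟩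

lemma branch (h1 : b.holds σ → Runs N P σ Q) (h2 : ¬ b.holds σ → Runs N R σ Q) :
    Runs N (.branch b P R) σ Q := by
  by_cases h : b.holds σ
  · obtain ⟨τ, σ', h3, h4, h5⟩ := h1 h
    refine ⟨_, _, .branch_true h h3, ?_, h5⟩
    simp only [Program.timePoly, Polynomial.eval_add, Polynomial.eval_C]
    omega
  · obtain ⟨τ, σ', h3, h4, h5⟩ := h2 h
    refine ⟨_, _, .branch_false h h3, ?_, h5⟩
    simp only [Program.timePoly, Polynomial.eval_add, Polynomial.eval_C]
    omega

/-- The rule for loops with an invariant `I d` that bounds the number of iterations by `d`. -/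
lemma loop {d : ℕ} (I : ℕ → Store → Prop) (hd : d ≤ N) (h0 : I d σ)
    (hI : ∀ d σ, I d σ → b.holds σ → Runs N P σ fun σ' => ∃ d' < d, I d' σ')
    (hQ : ∀ d σ, I d σ → ¬ b.holds σ → Q σ) : Runs N (.loop b P) σ Q := by
  -- Here the time is linear in the measure `d` itself, so that the induction goes through; the last
  -- summand pays for the final, failing test.
  have key : ∃ τ σ', Exec (.loop b P) σ τ σ' ∧
      τ ≤ d * (1 + b.cost + P.timePoly.eval N) + (1 + b.cost) ∧ Q σ' := by
    clear hd
    induction d using Nat.strong_induction_on generalizing σ with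
    | _ d ih =>
      by_cases hb : b.holds σ
      · obtain ⟨τ₁, σ₁, h1, h2, d', hd', h3⟩ := hI d σ h0 hb
        obtain ⟨τ₂, σ₂, h4, h5, h6⟩ := ih d' hd' h3
        refine ⟨_, _, .loop_true hb h1 h4, ?_, h6⟩
        have : (d' + 1) * (1 + b.cost + P.timePoly.eval N) ≤
            d * (1 + b.cost + P.timePoly.eval N) := Nat.mul_le_mul_right _ hd'
        linarith
      · exact ⟨_, _, .loop_false hb, Nat.le_add_left _ _, hQ d σ h0 hb⟩
  obtain ⟨τ, σ', h1, h2, h3⟩ := key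
  refine ⟨τ, σ', h1, h2.trans ?_, h3⟩
  simp only [Program.timePoly, Polynomial.eval_add, Polynomial.eval_mul, Polynomial.eval_X,
    Polynomial.eval_C, add_mul, one_mul]
  have := Nat.mul_le_mul_right (1 + b.cost + P.timePoly.eval N) hd
  simp only [mul_add] at this ⊢
  omega

end Runs

/-! ### Reading the memory after writes, and framing. -/

namespace Store

variable (σ : Store) (a i : ℕ)

lemma setNat_nat (x a' : ℕ) : (σ.setNat a i x).nat a' =
    if a' = a then Function.update (σ.nat a) i x else σ.nat a' := by
  funext j
  by_cases h : a' = a <;> by_cases h' : j = i <;> simp [setNat, h, h']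

lemma setReal_real (x : ℝ) (a' : ℕ) : (σ.setReal a i x).real a' =
    if a' = a then Function.update (σ.real a) i x else σ.real a' := by
  funext j
  by_cases h : a' = a <;> by_cases h' : j = i <;> simp [setReal, h, h']

lemma setNat_real (x : ℕ) : (σ.setNat a i x).real = σ.real := rfl

lemma setReal_nat (x : ℝ) : (σ.setReal a i x).nat = σ.nat := rfl

/-- The two memories agree outside the arrays of natural numbers listed in `S` and the arrays of
real numbers listed in `T`. -/
def SameOff (S T : List ℕ) (σ σ' : Store) : Prop :=
  (∀ a ∉ S, σ'.nat a = σ.nat a) ∧ ∀ b ∉ T, σ'.real b = σ.real b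

variable {σ} {σ' : Store} {S T : List ℕ}

lemma SameOff.refl : SameOff S T σ σ := ⟨fun _ _ => rfl, fun _ _ => rfl⟩

lemma SameOff.setNat {a i x : ℕ} (h : SameOff S T σ σ') (ha : a ∈ S) :
    SameOff S T σ (σ'.setNat a i x) := by
  refine ⟨fun a' ha' => ?_, h.2⟩
  rw [setNat_nat, if_neg (ne_of_mem_of_not_mem ha ha').symm, h.1 a' ha']

lemma SameOff.setReal {a i : ℕ} {x : ℝ} (h : SameOff S T σ σ') (ha : a ∈ T) :
    SameOff S T σ (σ'.setReal a i x) := by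
  refine ⟨h.1, fun a' ha' => ?_⟩
  rw [setReal_real, if_neg (ne_of_mem_of_not_mem ha ha').symm, h.2 a' ha']

end Store

/-- The scalar variable that is stored in cell `0` of array `a`. -/
def cell (a : ℕ) : NatExp := .get a (.const 0)

/-- Assignment to a scalar variable. -/
def setCell (a : ℕ) (e : NatExp) : Program := .setNat a (.const 0) e

/-- Equality test for natural numbers. -/
def natEq (e₁ e₂ : NatExp) : Test := .and (.natLe e₁ e₂) (.natLe e₂ e₁)

lemma holds_natEq {σ : Store} {e₁ e₂ : NatExp} :
    (natEq e₁ e₂).holds σ ↔ e₁.eval σ = e₂.eval σ := by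
  simp [natEq, Test.holds, le_antisymm_iff]

lemma eval_cell {σ : Store} {a : ℕ} : (cell a).eval σ = σ.nat a 0 := rfl

lemma Runs.setCell {N a : ℕ} {e : NatExp} {σ : Store} {Q : Store → Prop}
    (h : Q (σ.setNat a 0 (e.eval σ))) : Runs N (setCell a e) σ Q := Runs.setNat h

end RAM

namespace MinPower

/-! ### The residual network -/

section Residual

variable (m : ℕ) (A B : ℕ → ℕ) (C : ℕ → ℝ)

/-- The flow that a state `0`, `1` or `2` of an edge stands for. -/
def flowOfState (x : ℕ) : ℤ := if x = 0 then 0 else if x = 1 then 1 else -1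

/-- The state of an edge that is used from its first to its second end (`o = true`) or
vice versa. -/
def dirCode (o : Bool) : ℕ := cond o 1 2

/-- The tail of the arc that runs along edge `i` in direction `o`. -/
def tail (o : Bool) (i : ℕ) : ℕ := cond o (A i) (B i)

/-- The reduced residual cost of the arc that runs along edge `i` in direction `o`. -/
def redCost (x : ℕ → ℕ) (π : ℕ → ℝ) (i : ℕ) (o : Bool) : ℝ :=
  (if x i = 0 then C i else -C i) + π (tail A B o i) - π (tail A B (!o) i)

/-- `x` describes a flow with net outflow `g` and `π` proves that its cost is minimum. -/
structure OptFlow (x : ℕ → ℕ) (π : ℕ → ℝ) (g : ℕ → ℤ) : Prop where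
  le_two : ∀ i < m, x i ≤ 2
  redCost_nonneg : ∀ i < m, ∀ o, x i ≠ dirCode o → 0 ≤ redCost A B C x π i o
  netOut_eq : ∀ v, netOut (fun i : Fin m => A i) (fun i => B i)
    (fun i => flowOfState (x i)) v = g v

/-- The net outflow of a flow of value `j` from `s` to `t`. -/
def demand (s t : ℕ) (j : ℕ) (v : ℕ) : ℤ :=
  (j : ℤ) * ((if v = s then 1 else 0) - (if v = t then 1 else 0))

/-- The new state of an edge with state `y` along which one unit is sent in direction `o`. -/
def flipState (y : ℕ) (o : Bool) : ℕ := if y = 0 then dirCode o else 0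

/-- The nodes reached so far, those with `base < rank v`, form a tree of residual arcs of reduced
cost `0`; this is asserted for ranks at most `r`. -/
def IsTree (x : ℕ → ℕ) (π : ℕ → ℝ) (rank par : ℕ → ℕ) (base s r : ℕ) : Prop :=
  ∀ v, base < rank v → rank v ≤ r → v = s ∨ ∃ o, par v < m ∧ tail A B (!o) (par v) = v ∧
    x (par v) ≠ dirCode o ∧ redCost A B C x π (par v) o = 0 ∧
    base < rank (tail A B o (par v)) ∧ rank (tail A B o (par v)) < rank v

/-- The arc that runs along edge `i` in direction `o` is residual and leaves the set of
reached nodes. -/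
def Leaves (x rank : ℕ → ℕ) (base i : ℕ) (o : Bool) : Prop :=
  i < m ∧ base < rank (tail A B o i) ∧ rank (tail A B (!o) i) ≤ base ∧ x i ≠ dirCode o

variable {m A B C} {x : ℕ → ℕ} {π : ℕ → ℝ} {g : ℕ → ℤ} {rank par : ℕ → ℕ} {base s t r p : ℕ}
  {o : Bool}

lemma flowOfState_flipState {y : ℕ} (hy : y ≤ 2) (ho : y ≠ dirCode o) :
    flowOfState (flipState y o) = flowOfState y + cond o 1 (-1) := by
  cases o <;> interval_cases y <;> simp_all [flowOfState, flipState, dirCode]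

/-- Sending one unit along a residual arc of reduced cost `0` preserves optimality. -/
lemma OptFlow.flip (h : OptFlow m A B C x π g) (hC : 0 ≤ C p) (hp : p < m)
    (ho : x p ≠ dirCode o) (hr : redCost A B C x π p o = 0) :
    OptFlow m A B C (Function.update x p (flipState (x p) o)) π fun v =>
      g v + ((if v = tail A B o p then 1 else 0) - (if v = tail A B (!o) p then 1 else 0)) := by
  refine ⟨fun i hi => ?_, fun i hi o' ho' => ?_, fun v => ?_⟩
  · by_cases h' : i = p
    · subst h'
      rw [Function.update_self]
      cases o <;> unfold flipState <;> split_ifs <;> simp [dirCode]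
    · rw [Function.update_of_ne h']
      exact h.le_two i hi
  · by_cases h' : i = p
    · subst h'
      have h2 := h.le_two i hi
      have h3 := h.redCost_nonneg i hi
      -- A newly used edge has only its reverse arc, of reduced cost `0`. A cancelled edge becomes
      -- free: its arc in direction `o` has reduced cost `2 C i`, the reverse one `0`. This is where
      -- `C p ≥ 0` enters.
      cases o <;> cases o' <;> interval_cases hx : x i <;>
        simp_all [redCost, flipState, dirCode, tail] <;> linarith
    · rw [Function.update_of_ne h'] at ho'
      have := h.redCost_nonneg i hi o' ho'
      simpa [redCost, Function.update_of_ne h'] using this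
  · rw [← h.netOut_eq v, netOut, netOut, ← sub_eq_iff_eq_add', ← Finset.sum_sub_distrib,
      Finset.sum_eq_single ⟨p, hp⟩]
    · simp only [Function.update_self]
      rw [flowOfState_flipState (h.le_two p hp) ho, ← sub_mul]
      cases o <;> simp [tail, eq_comm (a := v)]
    · intro i _ hi
      have : (i : ℕ) ≠ p := fun h => hi (Fin.ext h)
      simp [this]
    · simp

/-- Raising the potentials of all nodes that are not reached by the minimum reduced cost of a
residual arc that leaves the reached nodes preserves optimality. -/
lemma OptFlow.raise (h : OptFlow m A B C x π g) {δ : ℝ} (hδ : 0 ≤ δ)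
    (hmin : ∀ i o, Leaves m A B x rank base i o → δ ≤ redCost A B C x π i o) :
    OptFlow m A B C x (fun v => if rank v ≤ base then π v + δ else π v) g := by
  refine ⟨h.le_two, fun i hi o ho => ?_, h.netOut_eq⟩
  have h1 := h.redCost_nonneg i hi o ho
  have h2 := hmin i o
  unfold redCost at *
  unfold Leaves at h2
  beta_reduce
  -- Only arcs from reached to unreached nodes lose `δ`, and `hmin` covers precisely those; the
  -- others keep or gain reduced cost.
  by_cases h3 : rank (tail A B o i) ≤ base <;> by_cases h4 : rank (tail A B (!o) i) ≤ base
  · rw [if_pos h3, if_pos h4]; linarith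
  · rw [if_pos h3, if_neg h4]; linarith
  · have := h2 ⟨hi, not_le.1 h3, h4, ho⟩
    rw [if_neg h3, if_pos h4]; linarith
  · rw [if_neg h3, if_neg h4]; linarith

/-- The tree of reached nodes is extended by the head of a residual arc of minimum
reduced cost. -/
lemma IsTree.extend {clock : ℕ} (h : IsTree m A B C x π rank par base s clock)
    (hr : ∀ v, rank v ≤ clock) (hl : Leaves m A B x rank base p o) :
    IsTree m A B C x
      (fun v => if rank v ≤ base then π v + redCost A B C x π p o else π v)
      (Function.update rank (tail A B (!o) p) (clock + 1))
      (Function.update par (tail A B (!o) p) p) base s (clock + 1) := by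
  obtain ⟨hp, h1, h2, h3⟩ := hl
  intro v hv hvr
  have hne : tail A B o p ≠ tail A B (!o) p := by
    intro h; rw [h] at h1; omega
  by_cases hvp : v = tail A B (!o) p
  · right
    refine ⟨o, ?_⟩
    subst hvp
    simp only [Function.update_self, Function.update_of_ne hne]
    refine ⟨hp, trivial, h3, ?_, h1, Nat.lt_succ_of_le (hr _)⟩
    -- The head is raised by exactly the old reduced cost of the new tree arc, which brings it to
    -- `0`.
    rw [redCost, if_neg (not_le.2 h1), if_pos h2, redCost]
    ring
  · rw [Function.update_of_ne hvp] at hv ⊢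
    rw [Function.update_of_ne hvp]
    refine (h v hv (hr v)).imp id ?_
    rintro ⟨o', g1, g2, g3, g4, g5, g6⟩
    have hne' : tail A B o' (par v) ≠ tail A B (!o) p := by
      intro h; rw [h] at g5; omega
    refine ⟨o', g1, g2, g3, ?_, ?_⟩
    · have g7 : ¬ rank (tail A B (!o') (par v)) ≤ base := by rw [g2]; omega
      rw [redCost, if_neg (not_le.2 g5), if_neg g7]
      exact g4
    · rw [Function.update_of_ne hne']
      exact ⟨g5, g6⟩

/-- Sending a unit along the arc into `v` leaves the tree below `v` intact. -/
lemma IsTree.flip {v : ℕ} (h : IsTree m A B C x π rank par base s (rank v))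
    (ho : tail A B (!o) (par v) = v)
    (hr : rank (tail A B o (par v)) < rank v) (y : ℕ) :
    IsTree m A B C (Function.update x (par v) y) π rank par base s
      (rank (tail A B o (par v))) := by
  intro w hw hwr
  refine (h w hw (by omega)).imp id ?_
  rintro ⟨o', g1, g2, g3, g4, g5, g6⟩
  -- The same edge in the same direction would force `w = v`; in the opposite direction its tail
  -- would be `v`, of smaller rank than `w`. Both contradict the order of ranks.
  have hne : par w ≠ par v := by
    intro heq
    rw [heq] at g2 g6
    by_cases hoo : o' = o
    · subst hoo
      rw [ho] at g2
      subst g2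
      omega
    · have : o' = !o := by cases o <;> cases o' <;> simp_all
      subst this
      rw [ho] at g6
      omega
  refine ⟨o', g1, g2, ?_, ?_, g5, g6⟩
  · rwa [Function.update_of_ne hne]
  · rw [← g4, redCost, redCost, Function.update_of_ne hne]

/-- Bounds the number of successful augmentations by the number of edges, whatever `k` is. -/
lemma OptFlow.value_le {j : ℕ} (hst : s ≠ t) (h : OptFlow m A B C x π (demand s t j)) :
    j ≤ m := by
  have : IsFlow (fun i : Fin m => A i) (fun i => B i) s t j fun i => flowOfState (x i) := by
    refine ⟨fun i => ?_, h.netOut_eq⟩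
    unfold flowOfState
    split_ifs <;> simp
  simpa using this.value_le_card hst

end Residual

open RAM

/-! ### The program

Array `3` holds the states of the edges, the real array `1` the potentials, arrays `5` and `6` the
ranks and parent edges of the nodes. The remaining arrays are scalar variables: `7` the flow value,
`8` a loop index, `9` the best edge plus one, `10` its head, `11` the clock, `12` the base of the
current round, `13` the current node of the path, `14` is nonzero after a failure, and the real
arrays `2` and `3` hold the least reduced cost and the current one. -/

/-- Compare the arc along edge number `8` in direction `o` with the best leaving arc so far. -/
def tryArc (o : Bool) : Program :=
  let u : NatExp := .get (dirCode o) (cell 8)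
  let v : NatExp := .get (dirCode !o) (cell 8)
  .branch (.and (.and (.not (.natLe (.get 5 u) (cell 12))) (.natLe (.get 5 v) (cell 12)))
      (.not (natEq (.get 3 (cell 8)) (.const (dirCode o)))))
    (.seq
      (.branch (natEq (.get 3 (cell 8)) (.const 0))
        (.setReal 3 (.const 0) (.get 0 (cell 8)))
        (.setReal 3 (.const 0) (.sub .zero (.get 0 (cell 8)))))
      (.seq
        (.setReal 3 (.const 0) (.sub (.add (.get 3 (.const 0)) (.get 1 u)) (.get 1 v)))
        (.branch (.and (.natLe (.const 1) (cell 9))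
            (.realLe (.get 2 (.const 0)) (.get 3 (.const 0))))
          .skip
          (.seq (setCell 9 (.add (cell 8) (.const 1)))
            (.seq (setCell 10 v) (.setReal 2 (.const 0) (.get 3 (.const 0))))))))
    .skip

/-- Find the leaving arc of least reduced cost. -/
def scanArcs : Program :=
  .seq (setCell 8 (.const 0)) (.seq (setCell 9 (.const 0))
    (.loop (.not (.natLe (.get 0 (.const 1)) (cell 8)))
      (.seq (tryArc true) (.seq (tryArc false) (setCell 8 (.add (cell 8) (.const 1)))))))

/-- Raise the potentials of the nodes that are not yet reached. -/
def raisePotentials : Program :=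
  .seq (setCell 8 (.const 0))
    (.loop (.not (.natLe (.get 0 (.const 0)) (cell 8)))
      (.seq
        (.branch (.natLe (.get 5 (cell 8)) (cell 12))
          (.setReal 1 (cell 8) (.add (.get 1 (cell 8)) (.get 2 (.const 0)))) .skip)
        (setCell 8 (.add (cell 8) (.const 1)))))

/-- Reach one more node, or fail. -/
def growTree : Program :=
  .seq scanArcs
    (.branch (natEq (cell 9) (.const 0)) (setCell 14 (.const 1))
      (.seq raisePotentials
        (.seq (setCell 11 (.add (cell 11) (.const 1)))
          (.seq (.setNat 5 (cell 10) (cell 11))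
            (.setNat 6 (cell 10) (.sub (cell 9) (.const 1)))))))

/-- Send one unit along the tree arc into the current node, and move to its tail. -/
def traceStep : Program :=
  let p : NatExp := .get 6 (cell 13)
  -- The other end of edge `p`: the current node is one of its two ends, so the truncated
  -- subtraction is exact.
  let u : NatExp := .sub (.add (.get 1 p) (.get 2 p)) (cell 13)
  .seq
    (.branch (natEq (.get 3 p) (.const 0))
      (.branch (natEq (.get 2 p) (cell 13)) (.setNat 3 p (.const 1)) (.setNat 3 p (.const 2)))
      (.setNat 3 p (.const 0)))
    (setCell 13 u)

/-- Increase the flow value by one, or fail. -/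
def augment : Program :=
  -- Moving the base up to the clock makes all old ranks count as unreached, without clearing the
  -- array.
  .seq (setCell 12 (cell 11))
    (.seq (setCell 11 (.add (cell 11) (.const 1)))
      (.seq (.setNat 5 (.get 0 (.const 2)) (cell 11))
        (.seq
          (.loop (.and (.natLe (.get 5 (.get 0 (.const 3))) (cell 12)) (natEq (cell 14) (.const 0)))
            growTree)
          (.branch (natEq (cell 14) (.const 0))
            (.seq (setCell 13 (.get 0 (.const 3)))
              (.seq (.loop (.not (natEq (cell 13) (.get 0 (.const 2)))) traceStep)
                (setCell 7 (.add (cell 7) (.const 1)))))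
            .skip))))

/-- The algorithm: successive augmentation. -/
def minCostProgram : Program :=
  -- For equal terminals the trivial path can be repeated `k` times, and the initial memory already
  -- encodes the empty solution.
  .branch (natEq (.get 0 (.const 2)) (.get 0 (.const 3))) (setCell 4 (.const 1))
    (.seq
      (.loop (.and (.not (.natLe (.get 0 (.const 4)) (cell 7))) (natEq (cell 14) (.const 0)))
        augment)
      (.branch (.natLe (.get 0 (.const 4)) (cell 7)) (setCell 4 (.const 1)) .skip))

/-! ### Its verification -/

/-! ### The search for the cheapest leaving arc. -/

section Scan

variable (m : ℕ) (A B : ℕ → ℕ) (C : ℕ → ℝ) (x : ℕ → ℕ) (π : ℕ → ℝ) (rank : ℕ → ℕ) (base : ℕ)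

/-- `best`, `head` and `δ` describe a leaving arc of least reduced cost among the arcs in `S`. -/
def IsBest (S : ℕ → Bool → Prop) (best head : ℕ) (δ : ℝ) : Prop :=
  (best = 0 ∧ ∀ i o, S i o → ¬ Leaves m A B x rank base i o) ∨
    ∃ p o, best = p + 1 ∧ head = tail A B (!o) p ∧ δ = redCost A B C x π p o ∧
      Leaves m A B x rank base p o ∧
      ∀ i o, S i o → Leaves m A B x rank base i o → δ ≤ redCost A B C x π i o

variable {m A B C x π rank base} {S : ℕ → Bool → Prop} {best head i : ℕ} {δ : ℝ} {o : Bool}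

/-- The hypothesis `hk` covers both an arc that does not leave, vacuously, and one that is no
improvement. -/
lemma IsBest.keep (h : IsBest m A B C x π rank base S best head δ)
    (hk : Leaves m A B x rank base i o → 1 ≤ best ∧ δ ≤ redCost A B C x π i o) :
    IsBest m A B C x π rank base (fun p q => S p q ∨ p = i ∧ q = o) best head δ := by
  rcases h with ⟨rfl, h⟩ | ⟨p, q, h1, h2, h3, h4, h5⟩
  · refine Or.inl ⟨rfl, ?_⟩
    rintro p q (h' | ⟨rfl, rfl⟩)
    · exact h p q h'
    · exact fun h' => by simpa using (hk h').1
  · refine Or.inr ⟨p, q, h1, h2, h3, h4, ?_⟩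
    rintro p' q' (h' | ⟨rfl, rfl⟩)
    · exact h5 p' q' h'
    · exact fun h' => (hk h').2

lemma IsBest.replace (h : IsBest m A B C x π rank base S best head δ)
    (hl : Leaves m A B x rank base i o)
    (hk : ¬ (1 ≤ best ∧ δ ≤ redCost A B C x π i o)) :
    IsBest m A B C x π rank base (fun p q => S p q ∨ p = i ∧ q = o) (i + 1) (tail A B (!o) i)
      (redCost A B C x π i o) := by
  refine Or.inr ⟨i, o, rfl, rfl, rfl, hl, ?_⟩
  rintro p' q' (h' | ⟨rfl, rfl⟩) hl'
  · rcases h with ⟨rfl, h⟩ | ⟨p, q, h1, h2, h3, h4, h5⟩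
    · exact absurd hl' (h _ _ h')
    · have := h5 _ _ h' hl'
      have : ¬ δ ≤ redCost A B C x π i o := fun h => hk ⟨by omega, h⟩
      linarith
  · exact le_rfl

lemma IsBest.congr {S' : ℕ → Bool → Prop} (h : IsBest m A B C x π rank base S best head δ)
    (hS : ∀ i o, i < m → (S i o ↔ S' i o)) : IsBest m A B C x π rank base S' best head δ := by
  rcases h with ⟨h1, h⟩ | ⟨p, q, h1, h2, h3, h4, h5⟩
  · exact Or.inl ⟨h1, fun i o hi hl => h i o ((hS i o hl.1).2 hi) hl⟩
  · exact Or.inr ⟨p, q, h1, h2, h3, h4, fun i o hi hl => h5 i o ((hS i o hl.1).2 hi) hl⟩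

end Scan

/-- `IsBest` for the contents of a memory. -/
def StoreBest (σ : Store) (S : ℕ → Bool → Prop) (σ' : Store) : Prop :=
  IsBest (σ.nat 0 1) (σ.nat 1) (σ.nat 2) (σ.real 0) (σ.nat 3) (σ.real 1) (σ.nat 5) (σ.nat 12 0) S
    (σ'.nat 9 0) (σ'.nat 10 0) (σ'.real 2 0)

/-- The code of a direction doubles as the number of the input array that holds the tails for that
direction. -/
lemma nat_dirCode (σ : Store) (o : Bool) (i : ℕ) :
    σ.nat (dirCode o) i = tail (σ.nat 1) (σ.nat 2) o i := by
  cases o <;> rfl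

lemma runs_tryArc {N : ℕ} {σ σ' : Store} {S : ℕ → Bool → Prop} (o : Bool)
    (hs : Store.SameOff [8, 9, 10] [2, 3] σ σ') (hb : StoreBest σ S σ')
    (hi : σ'.nat 8 0 < σ.nat 0 1) :
    Runs N (tryArc o) σ' fun σ'' => Store.SameOff [8, 9, 10] [2, 3] σ σ'' ∧
      σ''.nat 8 = σ'.nat 8 ∧
      StoreBest σ (fun p q => S p q ∨ p = σ'.nat 8 0 ∧ q = o) σ'' := by
  have e0 := hs.1 1 (by simp)
  have e1 := hs.1 2 (by simp)
  have e2 := hs.1 3 (by simp)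
  have e3 := hs.1 5 (by simp)
  have e4 := hs.1 12 (by simp)
  have f0 := hs.2 0 (by simp)
  unfold tryArc
  refine Runs.branch (fun h => ?_) (fun h => ?_)
  · simp only [Test.holds, nat_dirCode, eval_cell, holds_natEq, NatExp.eval,
      e0, e1, e2, e3, e4, not_le] at h
    have hl : Leaves (σ.nat 0 1) (σ.nat 1) (σ.nat 2) (σ.nat 3) (σ.nat 5) (σ.nat 12 0)
        (σ'.nat 8 0) o := ⟨hi, h.1.1, h.1.2, h.2⟩
    -- The two signs of the residual cost differ only in the first assignment; the remaining code is
    -- verified once for both.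
    have hrest : ∀ σ₁ : Store, Store.SameOff [8, 9, 10] [2, 3] σ σ₁ → σ₁.nat = σ'.nat →
        σ₁.real 2 = σ'.real 2 →
        σ₁.real 3 0 = (if σ.nat 3 (σ'.nat 8 0) = 0 then σ.real 0 (σ'.nat 8 0) else
          -σ.real 0 (σ'.nat 8 0)) →
        Runs N (.seq
        (.setReal 3 (.const 0) (.sub (.add (.get 3 (.const 0))
          (.get 1 (.get (dirCode o) (cell 8)))) (.get 1 (.get (dirCode !o) (cell 8)))))
        (.branch (.and (.natLe (.const 1) (cell 9))
            (.realLe (.get 2 (.const 0)) (.get 3 (.const 0))))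
          .skip
          (.seq (setCell 9 (.add (cell 8) (.const 1)))
            (.seq (setCell 10 (.get (dirCode !o) (cell 8)))
              (.setReal 2 (.const 0) (.get 3 (.const 0))))))) σ₁ fun σ'' =>
        Store.SameOff [8, 9, 10] [2, 3] σ σ'' ∧ σ''.nat 8 = σ'.nat 8 ∧
          StoreBest σ (fun p q => S p q ∨ p = σ'.nat 8 0 ∧ q = o) σ'' := by
      intro σ₁ hs₁ hn hr hv
      have g1 := hs₁.2 1 (by simp)
      refine Runs.seq (Runs.setReal ?_)
      have hrc : (RealExp.sub (.add (.get 3 (.const 0))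
          (.get 1 (.get (dirCode o) (cell 8)))) (.get 1 (.get (dirCode !o) (cell 8)))).eval σ₁ =
          redCost (σ.nat 1) (σ.nat 2) (σ.real 0) (σ.nat 3) (σ.real 1) (σ'.nat 8 0) o := by
        simp only [RealExp.eval, NatExp.eval, nat_dirCode, eval_cell, hv, g1, hn, e0, e1,
          redCost]
      rw [hrc]
      refine Runs.branch (fun h' => Runs.skip ?_) (fun h' => ?_)
      · refine ⟨hs₁.setReal (by simp), by simp [Store.setReal_nat, hn], ?_⟩
        simp only [Test.holds, NatExp.eval, RealExp.eval, eval_cell, Store.setReal_nat,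
          Store.setReal_real, hn, hr] at h'
        simp only [StoreBest, Store.setReal_nat, Store.setReal_real, hn, hr]
        exact IsBest.keep hb fun _ => by simpa using h'
      · refine Runs.seq (Runs.setCell (Runs.seq (Runs.setCell (Runs.setReal ?_))))
        simp only [Test.holds, NatExp.eval, RealExp.eval, eval_cell, Store.setReal_nat,
          Store.setReal_real, hn, hr] at h'
        refine ⟨(((hs₁.setReal (by simp)).setNat (by simp)).setNat (by simp)).setReal (by simp),
          by simp [Store.setReal_nat, Store.setNat_nat, hn], ?_⟩
        have := IsBest.replace hb hl (by simpa using h')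
        simp only [StoreBest, NatExp.eval, RealExp.eval, eval_cell, nat_dirCode]
        simpa [Store.setReal_nat, Store.setReal_real, Store.setNat_nat,
          Store.setNat_real, hn, e0, e1] using this
    refine Runs.seq (Runs.branch (fun h' => Runs.setReal ?_) (fun h' => Runs.setReal ?_)) <;>
      rw [holds_natEq] at h' <;>
      simp only [NatExp.eval, eval_cell, e2] at h' <;>
      refine hrest _ (hs.setReal (by simp)) rfl (by simp [Store.setReal_real]) ?_ <;>
      simp [Store.setReal_real, h', NatExp.eval, RealExp.eval, eval_cell, f0]
  · refine Runs.skip ⟨hs, rfl, IsBest.keep hb fun hl => absurd ?_ h⟩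
    simp only [Test.holds, nat_dirCode, eval_cell, holds_natEq, NatExp.eval,
      e0, e1, e2, e3, e4, not_le]
    exact ⟨⟨hl.2.1, hl.2.2.1⟩, hl.2.2.2⟩

lemma runs_scanArcs {N : ℕ} {σ : Store} (hN : σ.nat 0 1 ≤ N) :
    Runs N scanArcs σ fun σ' => Store.SameOff [8, 9, 10] [2, 3] σ σ' ∧
      StoreBest σ (fun _ _ => True) σ' := by
  refine Runs.seq (Runs.setCell (Runs.seq (Runs.setCell ?_)))
  refine Runs.loop (d := σ.nat 0 1) (fun d σ' => Store.SameOff [8, 9, 10] [2, 3] σ σ' ∧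
    d + σ'.nat 8 0 = σ.nat 0 1 ∧ StoreBest σ (fun p _ => p < σ'.nat 8 0) σ') hN ?_ ?_ ?_
  · refine ⟨(Store.SameOff.refl.setNat (by simp)).setNat (by simp), ?_, Or.inl ⟨?_, ?_⟩⟩
    · simp [Store.setNat_nat, NatExp.eval]
    · simp [Store.setNat_nat, NatExp.eval]
    · simp [Store.setNat_nat, NatExp.eval]
  · rintro d σ₁ ⟨hs, hd, hb⟩ h
    simp only [Test.holds, NatExp.eval, eval_cell, not_le, hs.1 0 (by simp)] at h
    refine Runs.seq ((runs_tryArc true hs hb h).mono ?_)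
    rintro σ₂ ⟨hs₂, h8, hb₂⟩
    refine Runs.seq ((runs_tryArc false hs₂ hb₂ (by rwa [h8])).mono ?_)
    rintro σ₃ ⟨hs₃, h8', hb₃⟩
    refine Runs.setCell ⟨d - 1, by omega, hs₃.setNat (by simp), ?_, ?_⟩
    · simp [Store.setNat_nat, NatExp.eval, eval_cell, h8, h8']
      omega
    · simp only [StoreBest, Store.setNat_nat, Store.setNat_real, NatExp.eval, eval_cell, h8, h8']
      refine IsBest.congr hb₃ fun i o _ => ?_
      cases o <;> simp [h8] <;> omega
  · rintro d σ₁ ⟨hs, hd, hb⟩ h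
    simp only [Test.holds, NatExp.eval, eval_cell, not_lt, not_le, hs.1 0 (by simp)] at h
    refine ⟨hs, IsBest.congr hb fun i o hi => ?_⟩
    simp
    omega

lemma runs_raisePotentials {N : ℕ} {σ : Store} (hN : σ.nat 0 0 ≤ N) :
    Runs N raisePotentials σ fun σ' => Store.SameOff [8] [1] σ σ' ∧
      ∀ v < σ.nat 0 0, σ'.real 1 v = if σ.nat 5 v ≤ σ.nat 12 0 then σ.real 1 v + σ.real 2 0
        else σ.real 1 v := by
  refine Runs.seq (Runs.setCell ?_)
  refine Runs.loop (d := σ.nat 0 0) (fun d σ' => Store.SameOff [8] [1] σ σ' ∧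
    d + σ'.nat 8 0 = σ.nat 0 0 ∧ ∀ v, σ'.real 1 v = if σ.nat 5 v ≤ σ.nat 12 0 ∧ v < σ'.nat 8 0
      then σ.real 1 v + σ.real 2 0 else σ.real 1 v) hN ?_ ?_ ?_
  · refine ⟨Store.SameOff.refl.setNat (by simp), ?_, ?_⟩
    · simp [Store.setNat_nat, NatExp.eval]
    · simp [Store.setNat_nat, Store.setNat_real, NatExp.eval]
  · rintro d σ₁ ⟨hs, hd, hv⟩ h
    simp only [Test.holds, NatExp.eval, eval_cell, not_le, hs.1 0 (by simp)] at h
    have e5 := hs.1 5 (by simp)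
    have e12 := hs.1 12 (by simp)
    have f2 := hs.2 2 (by simp)
    refine Runs.seq (Runs.branch (fun h' => Runs.setReal ?_) (fun h' => Runs.skip ?_)) <;>
      simp only [Test.holds, NatExp.eval, eval_cell, e5, e12] at h'
    · refine Runs.setCell ⟨d - 1, by omega, (hs.setReal (by simp)).setNat (by simp), ?_, ?_⟩
      · simp [Store.setNat_nat, Store.setReal_nat, NatExp.eval, eval_cell]
        omega
      · intro v
        simp only [Store.setNat_nat, Store.setNat_real, Store.setReal_nat, Store.setReal_real,
          NatExp.eval, RealExp.eval, eval_cell, if_true, Function.update_self]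
        by_cases hvi : v = σ₁.nat 8 0
        · subst hvi
          simp [hv, h', f2]
        · rw [Function.update_of_ne hvi, hv]
          simp only [Order.lt_add_one_iff, le_iff_lt_or_eq, hvi, or_false]
    · refine Runs.setCell ⟨d - 1, by omega, hs.setNat (by simp), ?_, ?_⟩
      · simp [Store.setNat_nat, NatExp.eval, eval_cell]
        omega
      · intro v
        simp only [Store.setNat_nat, Store.setNat_real,
          NatExp.eval, eval_cell, if_true, Function.update_self, hv]
        by_cases hvi : v = σ₁.nat 8 0
        · subst hvi
          simp [h']
        · simp only [Order.lt_add_one_iff, le_iff_lt_or_eq, hvi, or_false]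
  · rintro d σ₁ ⟨hs, hd, hv⟩ h
    simp only [Test.holds, NatExp.eval, eval_cell, not_lt, not_le, hs.1 0 (by simp)] at h
    refine ⟨hs, fun v hv' => ?_⟩
    rw [hv]
    simp only [hv'.trans_le h, and_true]

/-! ### Only potentials at actual nodes matter. -/

section Congr

variable {m n : ℕ} {A B : ℕ → ℕ} {C : ℕ → ℝ} {x : ℕ → ℕ} {π π' : ℕ → ℝ}

lemma tail_lt (hA : ∀ i < m, A i < n) (hB : ∀ i < m, B i < n) {i : ℕ} (hi : i < m) (o : Bool) :
    tail A B o i < n := by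
  cases o
  · exact hB i hi
  · exact hA i hi

/-- The program updates potentials at nodes below `n` only, while `OptFlow.raise` changes them at
all natural numbers; edges do not see the difference. -/
lemma redCost_congr (hA : ∀ i < m, A i < n) (hB : ∀ i < m, B i < n)
    (h : ∀ v < n, π' v = π v) {i : ℕ} (hi : i < m) (o : Bool) :
    redCost A B C x π' i o = redCost A B C x π i o := by
  rw [redCost, redCost, h _ (tail_lt hA hB hi _), h _ (tail_lt hA hB hi _)]

lemma OptFlow.congr {g : ℕ → ℤ} (hA : ∀ i < m, A i < n) (hB : ∀ i < m, B i < n)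
    (h : ∀ v < n, π' v = π v) (hf : OptFlow m A B C x π g) : OptFlow m A B C x π' g :=
  ⟨hf.le_two, fun i hi o ho => by
    rw [redCost_congr hA hB h hi]
    exact hf.redCost_nonneg i hi o ho, hf.netOut_eq⟩

lemma IsTree.congr {rank par : ℕ → ℕ} {base s r : ℕ} (hA : ∀ i < m, A i < n)
    (hB : ∀ i < m, B i < n) (h : ∀ v < n, π' v = π v)
    (hf : IsTree m A B C x π rank par base s r) : IsTree m A B C x π' rank par base s r := by
  intro v hv hvr
  refine (hf v hv hvr).imp id ?_
  rintro ⟨o, h1, h2, h3, h4, h5⟩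
  exact ⟨o, h1, h2, h3, by rwa [redCost_congr hA hB h h1], h5⟩

end Congr

/-! ### Invariants and the main loops. -/

/-- The conditions on the input: `I` holds the numbers of nodes and edges, the two terminals and
the number of paths, `A` and `B` the ends and `C` the costs of the edges. -/
structure IsInput (I A B : ℕ → ℕ) (C : ℕ → ℝ) : Prop where
  left_lt : ∀ i < I 1, A i < I 0
  right_lt : ∀ i < I 1, B i < I 0
  cost_nonneg : ∀ i < I 1, 0 ≤ C i
  source_lt : I 2 < I 0
  target_lt : I 3 < I 0
  source_ne : I 2 ≠ I 3

/-- The memory still holds the input, and no solution has been reported. -/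
structure HasInput (I A B : ℕ → ℕ) (C : ℕ → ℝ) (σ : Store) : Prop where
  nat_zero : σ.nat 0 = I
  nat_one : σ.nat 1 = A
  nat_two : σ.nat 2 = B
  nat_four : σ.nat 4 0 = 0
  real_zero : σ.real 0 = C

lemma HasInput.of_sameOff {I A B : ℕ → ℕ} {C : ℕ → ℝ} {σ σ' : Store} {S T : List ℕ}
    (h : HasInput I A B C σ) (hs : Store.SameOff S T σ σ')
    (hS : 0 ∉ S ∧ 1 ∉ S ∧ 2 ∉ S ∧ 4 ∉ S) (hT : 0 ∉ T) : HasInput I A B C σ' :=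
  ⟨(hs.1 _ hS.1).trans h.1, (hs.1 _ hS.2.1).trans h.2, (hs.1 _ hS.2.2.1).trans h.3,
    by rw [hs.1 _ hS.2.2.2, h.4], (hs.2 _ hT).trans h.5⟩

/-- No residual arc leaves a certain set of nodes that contains `s` but not `t`. -/
def Blocked (m : ℕ) (A B : ℕ → ℕ) (s t : ℕ) (x : ℕ → ℕ) : Prop :=
  ∃ S : ℕ → Prop, S s ∧ ¬ S t ∧
    ∀ i < m, ∀ o, x i ≠ dirCode o → S (tail A B o i) → S (tail A B (!o) i)

/-- The number of nodes that are not yet reached. -/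
def numUnreached (σ : Store) : ℕ :=
  ((Finset.range (σ.nat 0 0)).filter fun v => σ.nat 5 v ≤ σ.nat 12 0).card

/-- The invariant of the search for an augmenting path for a flow of value `j`. -/
structure SearchInv (I A B : ℕ → ℕ) (C : ℕ → ℝ) (j : ℕ) (σ : Store) : Prop where
  input : HasInput I A B C σ
  value : σ.nat 7 0 = j
  opt : OptFlow (I 1) A B C (σ.nat 3) (σ.real 1) (demand (I 2) (I 3) j)
  rank_le : ∀ v, σ.nat 5 v ≤ σ.nat 11 0
  tree : IsTree (I 1) A B C (σ.nat 3) (σ.real 1) (σ.nat 5) (σ.nat 6) (σ.nat 12 0) (I 2)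
    (σ.nat 11 0)
  root : σ.nat 12 0 < σ.nat 5 (I 2)
  count : σ.nat 11 0 - σ.nat 12 0 + numUnreached σ ≤ I 0
  fail : σ.nat 14 0 ≠ 0 → Blocked (I 1) A B (I 2) (I 3) (σ.nat 3)

/-- The invariant of successive augmentation at a flow of value `j`. -/
structure FlowInv (I A B : ℕ → ℕ) (C : ℕ → ℝ) (j : ℕ) (σ : Store) : Prop where
  input : HasInput I A B C σ
  value : σ.nat 7 0 = j
  opt : OptFlow (I 1) A B C (σ.nat 3) (σ.real 1) (demand (I 2) (I 3) j)
  rank_le : ∀ v, σ.nat 5 v ≤ σ.nat 11 0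
  value_le : j ≤ I 4
  fail : σ.nat 14 0 ≠ 0 → Blocked (I 1) A B (I 2) (I 3) (σ.nat 3)

variable {I A B : ℕ → ℕ} {C : ℕ → ℝ} {N j : ℕ} {σ : Store}

lemma runs_growTree (hI : IsInput I A B C) (hn : I 0 ≤ N) (hm : I 1 ≤ N)
    (h : SearchInv I A B C j σ) (ht : σ.nat 5 (I 3) ≤ σ.nat 12 0) :
    Runs N growTree σ fun σ' => SearchInv I A B C j σ' ∧
      (σ'.nat 14 0 ≠ 0 ∨ numUnreached σ' < numUnreached σ) := by
  have hin := h.input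
  refine Runs.seq ((runs_scanArcs (by rwa [hin.nat_zero])).mono ?_)
  rintro σ₁ ⟨hs₁, hb⟩
  rw [StoreBest, hin.nat_zero, hin.nat_one, hin.nat_two, hin.real_zero] at hb
  refine Runs.branch (fun h9 => Runs.setCell ?_) (fun h9 => ?_) <;> rw [holds_natEq] at h9 <;>
    simp only [NatExp.eval, eval_cell] at h9
  · rw [NatExp.eval]
    have hs₂ : Store.SameOff [8, 9, 10, 14] [2, 3] σ (σ₁.setNat 14 0 1) := by
      refine Store.SameOff.setNat ⟨fun a ha => hs₁.1 a ?_, hs₁.2⟩ (by simp)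
      simp only [List.mem_cons, not_or] at ha ⊢
      tauto
    have hblock : Blocked (I 1) A B (I 2) (I 3) (σ.nat 3) := by
      -- The blocking set consists of the reached nodes: the scan found no leaving arc.
      refine ⟨fun v => σ.nat 12 0 < σ.nat 5 v, h.root, not_lt.2 ht, fun i hi o ho hS => ?_⟩
      rcases hb with ⟨-, hb⟩ | ⟨p, o', hp, -⟩
      · by_contra hS'
        exact hb i o trivial ⟨hi, hS, not_lt.1 hS', ho⟩
      · omega
    refine ⟨⟨hin.of_sameOff hs₂ (by simp) (by simp), ?_, ?_, ?_, ?_, ?_, ?_, fun _ => ?_⟩,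
      Or.inl ?_⟩
    · rw [hs₂.1 7 (by simp), h.value]
    · rw [hs₂.1 3 (by simp), hs₂.2 1 (by simp)]
      exact h.opt
    · rw [hs₂.1 5 (by simp), hs₂.1 11 (by simp)]
      exact h.rank_le
    · rw [hs₂.1 3 (by simp), hs₂.1 5 (by simp), hs₂.1 6 (by simp), hs₂.1 12 (by simp),
        hs₂.1 11 (by simp), hs₂.2 1 (by simp)]
      exact h.tree
    · rw [hs₂.1 5 (by simp), hs₂.1 12 (by simp)]
      exact h.root
    · rw [numUnreached, hs₂.1 0 (by simp), hs₂.1 5 (by simp), hs₂.1 12 (by simp),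
        hs₂.1 11 (by simp)]
      exact h.count
    · rwa [hs₂.1 3 (by simp)]
    · simp [Store.setNat_nat]
  · rcases hb with ⟨hb, -⟩ | ⟨p, o, h1, h2, h3, hl, hmin⟩
    · exact absurd hb h9
    refine Runs.seq ((runs_raisePotentials (by rwa [hs₁.1 0 (by simp), hin.nat_zero])).mono ?_)
    rintro σ₂ ⟨hs₂, hπ⟩
    refine Runs.seq (Runs.setCell (Runs.seq (Runs.setNat (Runs.setNat ?_))))
    have e (a : ℕ) (ha : a ∉ [8, 9, 10]) : σ₂.nat a = σ.nat a := by
      rw [hs₂.1 a (by simp_all), hs₁.1 a ha]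
    have e9 : σ₂.nat 9 0 = p + 1 := by rw [hs₂.1 9 (by simp), h1]
    have e10 : σ₂.nat 10 0 = tail A B (!o) p := by rw [hs₂.1 10 (by simp), h2]
    have f0 : σ₂.real 0 = C := by rw [hs₂.2 0 (by simp), hs₁.2 0 (by simp), hin.real_zero]
    have hlt := hl.2.2.1
    have hhead := tail_lt hI.left_lt hI.right_lt hl.1 (!o)
    set w := tail A B (!o) p with hw
    simp only [NatExp.eval, eval_cell, Store.setNat_nat]
    simp only [Nat.reduceEqDiff, ↓reduceIte, e9, e10, e 11 (by simp),
      Function.update_self, Nat.add_sub_cancel]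
    set σ₃ := ((σ₂.setNat 11 0 (σ.nat 11 0 + 1)).setNat 5 w (σ.nat 11 0 + 1)).setNat 6 w p with hσ₃
    have g0 : σ₃.nat 0 = I := by simp [hσ₃, Store.setNat_nat, e, hin.nat_zero]
    have g1 : σ₃.nat 1 = A := by simp [hσ₃, Store.setNat_nat, e, hin.nat_one]
    have g2 : σ₃.nat 2 = B := by simp [hσ₃, Store.setNat_nat, e, hin.nat_two]
    have g3 : σ₃.nat 3 = σ.nat 3 := by simp [hσ₃, Store.setNat_nat, e]
    have g4 : σ₃.nat 4 = σ.nat 4 := by simp [hσ₃, Store.setNat_nat, e]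
    have g5 : σ₃.nat 5 = Function.update (σ.nat 5) w (σ.nat 11 0 + 1) := by
      simp [hσ₃, Store.setNat_nat, e]
    have g6 : σ₃.nat 6 = Function.update (σ.nat 6) w p := by simp [hσ₃, Store.setNat_nat, e]
    have g7 : σ₃.nat 7 = σ.nat 7 := by simp [hσ₃, Store.setNat_nat, e]
    have g11 : σ₃.nat 11 0 = σ.nat 11 0 + 1 := by simp [hσ₃, Store.setNat_nat]
    have g12 : σ₃.nat 12 = σ.nat 12 := by simp [hσ₃, Store.setNat_nat, e]
    have g14 : σ₃.nat 14 = σ.nat 14 := by simp [hσ₃, Store.setNat_nat, e]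
    have k0 : σ₃.real 0 = C := f0
    have k1 : ∀ v < I 0, σ₃.real 1 v = if σ.nat 5 v ≤ σ.nat 12 0 then
        σ.real 1 v + redCost A B C (σ.nat 3) (σ.real 1) p o else σ.real 1 v := by
      intro v hv
      have := hπ v (by rwa [hs₁.1 0 (by simp), hin.nat_zero])
      rwa [hs₁.1 5 (by simp), hs₁.1 12 (by simp), hs₁.2 1 (by simp), h3] at this
    have hbase : σ.nat 12 0 ≤ σ.nat 11 0 := h.root.le.trans (h.rank_le _)
    have hnum : numUnreached σ₃ < numUnreached σ := by
      rw [numUnreached, numUnreached, g0, g5, g12, hin.nat_zero]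
      refine Finset.card_lt_card ((Finset.ssubset_iff_of_subset fun v hv => ?_).2 ⟨w, ?_, ?_⟩)
      · simp only [Finset.mem_filter] at hv ⊢
        refine ⟨hv.1, ?_⟩
        by_cases hvw : v = w
        · rw [hvw]; exact hlt
        · simpa [hvw] using hv.2
      · simp [hhead, hlt]
      · simp
        omega
    refine ⟨⟨⟨g0, g1, g2, by rw [g4, hin.nat_four], k0⟩, by rw [g7, h.value], ?_, ?_, ?_, ?_, ?_, ?_⟩,
      Or.inr hnum⟩
    · rw [g3]
      refine OptFlow.congr hI.left_lt hI.right_lt k1 (h.opt.raise ?_ ?_)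
      · exact h.opt.redCost_nonneg p hl.1 o hl.2.2.2
      · intro i o' hl'
        exact h3 ▸ hmin i o' trivial hl'
    · intro v
      rw [g5, g11]
      by_cases hvw : v = w
      · simp [hvw]
      · simpa [hvw] using (h.rank_le v).trans (Nat.le_succ _)
    · rw [g3, g5, g6, g12, g11]
      exact IsTree.congr hI.left_lt hI.right_lt k1 (h.tree.extend h.rank_le hl)
    · rw [g5, g12]
      by_cases hsw : I 2 = w
      · rw [hsw, Function.update_self]
        omega
      · rw [Function.update_of_ne hsw]
        exact h.root
    · have := h.count
      rw [g11, g12]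
      omega
    · rw [g14, g3]
      exact h.fail

lemma demand_succ (s t j v : ℕ) : demand s t j v +
    ((if v = s then 1 else 0) - (if v = t then 1 else 0)) = demand s t (j + 1) v := by
  simp only [demand]
  push_cast
  ring

/-- The part of the search invariant that is needed to trace back the augmenting path. -/
def TraceInv (I A B : ℕ → ℕ) (C : ℕ → ℝ) (j : ℕ) (σ : Store) (d : ℕ) (σ' : Store) : Prop :=
  Store.SameOff [3, 13] [] σ σ' ∧ σ.nat 12 0 < σ.nat 5 (σ'.nat 13 0) ∧
    σ.nat 5 (σ'.nat 13 0) ≤ σ.nat 12 0 + d ∧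
    OptFlow (I 1) A B C (σ'.nat 3) (σ.real 1) (fun v => demand (I 2) (I 3) j v +
      ((if v = σ'.nat 13 0 then 1 else 0) - (if v = I 3 then 1 else 0))) ∧
    IsTree (I 1) A B C (σ'.nat 3) (σ.real 1) (σ.nat 5) (σ.nat 6) (σ.nat 12 0) (I 2)
      (σ.nat 5 (σ'.nat 13 0))

lemma runs_traceStep (hI : IsInput I A B C) (hin : HasInput I A B C σ) {d : ℕ} {σ' : Store}
    (h : TraceInv I A B C j σ d σ') (hs : σ'.nat 13 0 ≠ I 2) :
    Runs N traceStep σ' fun σ'' => ∃ d' < d, TraceInv I A B C j σ d' σ'' := by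
  obtain ⟨hoff, h1, h2, h3, h4⟩ := h
  obtain ⟨o, hp, hv, hx, hr, hb, hlt⟩ := (h4 _ h1 le_rfl).resolve_left hs
  have e1 := (hoff.1 1 (by simp)).trans hin.nat_one
  have e2 := (hoff.1 2 (by simp)).trans hin.nat_two
  have e6 := hoff.1 6 (by simp)
  set v := σ'.nat 13 0 with hv0
  set p := σ.nat 6 v with hp0
  -- Ranks strictly increase along a tree arc, so it is not a loop; hence comparing `B p` with `v`
  -- determines the direction.
  have hne : A p ≠ B p := by
    intro hAB
    have : tail A B o p = tail A B (!o) p := by cases o <;> simp [tail, hAB]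
    rw [this, hv] at hlt
    exact lt_irrefl _ hlt
  have hu : A p + B p - v = tail A B o p := by
    rw [← hv]
    cases o <;> simp [tail]
  have hdir : B p = v ↔ o = true := by
    rw [← hv]
    cases o <;> simp [tail, hne.symm]
  have hend : ∀ y, y = flipState (σ'.nat 3 p) o → Runs N
      (setCell 13 (.sub (.add (.get 1 (.get 6 (cell 13))) (.get 2 (.get 6 (cell 13)))) (cell 13)))
      (σ'.setNat 3 p y) fun σ'' => ∃ d' < d, TraceInv I A B C j σ d' σ'' := by
    rintro _ rfl
    refine Runs.setCell ⟨d - 1, by omega, (hoff.setNat (by simp)).setNat (by simp), ?_⟩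
    have h13 : NatExp.eval (σ'.setNat 3 p (flipState (σ'.nat 3 p) o))
        (.sub (.add (.get 1 (.get 6 (cell 13))) (.get 2 (.get 6 (cell 13)))) (cell 13)) =
        tail A B o p := by
      simp [NatExp.eval, eval_cell, Store.setNat_nat, e1, e2, e6, ← hv0, ← hp0, hu]
    rw [h13]
    have g13 : ((σ'.setNat 3 p (flipState (σ'.nat 3 p) o)).setNat 13 0 (tail A B o p)).nat 13 0 =
        tail A B o p := by simp [Store.setNat_nat]
    have g3 : ((σ'.setNat 3 p (flipState (σ'.nat 3 p) o)).setNat 13 0 (tail A B o p)).nat 3 =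
        Function.update (σ'.nat 3) p (flipState (σ'.nat 3 p) o) := by simp [Store.setNat_nat]
    rw [g13, g3]
    refine ⟨hb, by omega, ?_, h4.flip hv hlt _⟩
    -- The extra unit, which so far ran from `v` to `I 3`, now starts at the tail of the tree arc.
    have := h3.flip (hI.cost_nonneg p hp) hp hx hr
    convert this using 2 with w
    rw [hv]
    ring
  have hpe : NatExp.eval σ' (.get 6 (cell 13)) = p := by
    simp [NatExp.eval, eval_cell, e6, ← hv0, ← hp0]
  refine Runs.seq (Runs.branch (fun hc => Runs.branch (fun hc' => Runs.setNat ?_)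
    (fun hc' => Runs.setNat ?_)) (fun hc => Runs.setNat ?_)) <;> rw [hpe] <;> apply hend <;>
    simp only [holds_natEq, NatExp.eval, eval_cell, e2, e6, ← hv0, ← hp0] at *
  · simp [flipState, hc, hdir.1 hc', dirCode]
  · have : o = false := by
      cases o
      · rfl
      · exact absurd (hdir.2 rfl) hc'
    simp [flipState, hc, this, dirCode]
  · simp [flipState, hc]

lemma runs_augment (hI : IsInput I A B C) (hn : I 0 ≤ N) (hm : I 1 ≤ N)
    (h : FlowInv I A B C j σ) (hj : j < I 4) :
    Runs N augment σ fun σ' =>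
      (FlowInv I A B C j σ' ∧ σ'.nat 14 0 ≠ 0) ∨ (FlowInv I A B C (j + 1) σ' ∧ σ'.nat 14 0 = 0) := by
  have hin := h.input
  refine Runs.seq (Runs.setCell (Runs.seq (Runs.setCell (Runs.seq (Runs.setNat (Runs.seq ?_))))))
  simp only [NatExp.eval, eval_cell, Store.setNat_nat]
  simp only [Nat.reduceEqDiff, ↓reduceIte, OfNat.zero_ne_ofNat,
    Function.update_self, hin.nat_zero]
  set σ₁ := ((σ.setNat 12 0 (σ.nat 11 0)).setNat 11 0 (σ.nat 11 0 + 1)).setNat 5 (I 2)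
    (σ.nat 11 0 + 1) with hσ₁
  have hs₁ : Store.SameOff [5, 11, 12] [] σ σ₁ :=
    ((Store.SameOff.refl.setNat (by simp)).setNat (by simp)).setNat (by simp)
  have g5 : σ₁.nat 5 = Function.update (σ.nat 5) (I 2) (σ.nat 11 0 + 1) := by
    simp [hσ₁, Store.setNat_nat]
  have g11 : σ₁.nat 11 0 = σ.nat 11 0 + 1 := by simp [hσ₁, Store.setNat_nat]
  have g12 : σ₁.nat 12 0 = σ.nat 11 0 := by simp [hσ₁, Store.setNat_nat]
  have hle : ∀ v, v ≠ I 2 → σ₁.nat 5 v ≤ σ.nat 11 0 := by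
    intro v hv
    simpa [g5, hv] using h.rank_le v
  have hinv : SearchInv I A B C j σ₁ := by
    refine ⟨hin.of_sameOff hs₁ (by simp) (by simp), ?_, ?_, ?_, ?_, ?_, ?_, ?_⟩
    · rw [hs₁.1 7 (by simp), h.value]
    · rw [hs₁.1 3 (by simp), hs₁.2 1 (by simp)]
      exact h.opt
    · intro v
      rw [g11]
      by_cases hv : v = I 2
      · simp [g5, hv]
      · exact (hle v hv).trans (Nat.le_succ _)
    -- At the start of the round, `I 2` is the only node of rank above the base.
    · intro v hv _
      by_contra hv'
      have := hle v fun h => hv' (Or.inl h)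
      omega
    · simp [g5, g12]
    · have : numUnreached σ₁ ≤ ((Finset.range (I 0)).erase (I 2)).card := by
        rw [numUnreached, hs₁.1 0 (by simp), hin.nat_zero]
        refine Finset.card_le_card fun v hv => ?_
        rw [Finset.mem_filter] at hv
        refine Finset.mem_erase.2 ⟨?_, hv.1⟩
        rintro rfl
        have := hv.2
        simp [g5, g12] at this
      rw [Finset.card_erase_of_mem (Finset.mem_range.2 hI.source_lt), Finset.card_range] at this
      have := hI.source_lt
      omega
    · rw [hs₁.1 14 (by simp), hs₁.1 3 (by simp)]
      exact h.fail
  -- The measure must bound the unreached nodes only while there is no failure, since a failure ends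
  -- the loop. It is positive in the body because the target is still unreached.
  refine Runs.loop (d := I 0) (fun d σ' => SearchInv I A B C j σ' ∧
    (σ'.nat 14 0 = 0 → numUnreached σ' ≤ d)) hn
    ⟨hinv, fun _ => (Nat.le_add_left _ _).trans hinv.count⟩ ?_ ?_
  · rintro d σ₂ ⟨h₂, hd⟩ hb
    simp only [Test.holds, holds_natEq, NatExp.eval, eval_cell, h₂.input.nat_zero] at hb
    refine (runs_growTree hI hn hm h₂ hb.1).mono ?_
    have hpos : 0 < numUnreached σ₂ := by
      refine Finset.card_pos.2 ⟨I 3, Finset.mem_filter.2 ⟨?_, hb.1⟩⟩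
      rw [h₂.input.nat_zero]
      exact Finset.mem_range.2 hI.target_lt
    have := hd hb.2
    rintro σ₃ ⟨h₃, h₄⟩
    refine ⟨d - 1, by omega, h₃, fun h₅ => ?_⟩
    have := h₄.resolve_left (not_not.2 h₅)
    omega
  · rintro d σ₂ ⟨h₂, -⟩ hb
    simp only [Test.holds, holds_natEq, NatExp.eval, eval_cell, h₂.input.nat_zero, not_and] at hb
    refine Runs.branch (fun h14 => ?_) (fun h14 => Runs.skip ?_) <;>
      simp only [holds_natEq, NatExp.eval, eval_cell] at h14
    · have ht : σ₂.nat 12 0 < σ₂.nat 5 (I 3) := not_le.1 fun h => hb h h14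
      refine Runs.seq (Runs.setCell (Runs.seq ?_))
      have e : NatExp.eval σ₂ (.get 0 (.const 3)) = I 3 := by
        simp [NatExp.eval, h₂.input.nat_zero]
      rw [e]
      refine Runs.loop (d := I 0) (TraceInv I A B C j σ₂) hn ?_ ?_ ?_
      · have h13 : (σ₂.setNat 13 0 (I 3)).nat 13 0 = I 3 := by simp [Store.setNat_nat]
        have h3 : (σ₂.setNat 13 0 (I 3)).nat 3 = σ₂.nat 3 := by simp [Store.setNat_nat]
        refine ⟨Store.SameOff.refl.setNat (by simp), ?_⟩
        rw [h13, h3]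
        refine ⟨ht, ?_, ?_, fun v hv _ => h₂.tree v hv (h₂.rank_le v)⟩
        -- The field `count` bounds clock minus base, hence the rank of the target above the base
        -- and the length of the traceback, by the number of nodes.
        · have := h₂.rank_le (I 3)
          have := h₂.count
          omega
        -- Initially the extra unit runs from the target to itself and cancels.
        · convert h₂.opt using 2
          ring
      · intro d' σ₃ h₃ hb'
        refine runs_traceStep hI h₂.input h₃ ?_
        simpa [Test.holds, holds_natEq, NatExp.eval, eval_cell, h₃.1.1 0 (by simp),
          h₂.input.nat_zero] using hb'
      · intro d' σ₃ h₃ hb'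
        simp only [Test.holds, holds_natEq, NatExp.eval, eval_cell, h₃.1.1 0 (by simp),
          h₂.input.nat_zero, not_not] at hb'
        obtain ⟨hs₃, -, -, hopt, -⟩ := h₃
        refine Runs.setCell (Or.inr ⟨⟨?_, ?_, ?_, ?_, hj, ?_⟩, ?_⟩)
        · exact h₂.input.of_sameOff (S := [3, 13, 7]) (T := [])
            (Store.SameOff.setNat ⟨fun a ha => hs₃.1 a (by simp_all), hs₃.2⟩ (by simp))
            (by simp) (by simp)
        · simp [Store.setNat_nat, NatExp.eval, eval_cell, hs₃.1 7 (by simp), h₂.value]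
        · simp only [Store.setNat_nat, Store.setNat_real]
          rw [hs₃.2 1 (by simp)]
          simp only [hb', demand_succ] at hopt
          exact hopt
        · intro v
          simpa [Store.setNat_nat, hs₃.1 5 (by simp), hs₃.1 11 (by simp)] using h₂.rank_le v
        · simp [Store.setNat_nat, hs₃.1 14 (by simp), h14]
        · simp [Store.setNat_nat, hs₃.1 14 (by simp), h14]
    · exact Or.inl ⟨⟨h₂.input, h₂.value, h₂.opt, h₂.rank_le, hj.le, h₂.fail⟩, h14⟩

/-- The final memory of the algorithm. -/
lemma runs_minCostProgram (hI : IsInput I A B C) (hn : I 0 ≤ N) (hm : I 1 < N)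
    (h : FlowInv I A B C 0 σ) :
    Runs N minCostProgram σ fun σ' => ∃ j ≤ I 4,
      OptFlow (I 1) A B C (σ'.nat 3) (σ'.real 1) (demand (I 2) (I 3) j) ∧
      (σ'.nat 4 0 ≠ 0 → j = I 4) ∧
      (σ'.nat 4 0 = 0 → j < I 4 ∧ Blocked (I 1) A B (I 2) (I 3) (σ'.nat 3)) := by
  refine Runs.branch (fun hst => ?_) (fun _ => Runs.seq ?_)
  · simp only [holds_natEq, NatExp.eval, h.input.nat_zero] at hst
    exact absurd hst hI.source_ne
  -- Each round raises the flow value, at most to the number of edges, or sets the failure flag; the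
  -- `+ 1` is for the failing round.
  refine Runs.loop (d := I 1 + 1) (fun d σ' => ∃ j, FlowInv I A B C j σ' ∧
    I 1 - j + (if σ'.nat 14 0 = 0 then 1 else 0) ≤ d) hm ⟨0, h, ?_⟩ ?_ ?_
  · split_ifs <;> omega
  · rintro d σ₁ ⟨j, h₁, hd⟩ hb
    simp only [Test.holds, holds_natEq, NatExp.eval, eval_cell, h₁.input.nat_zero, h₁.value,
      not_le] at hb
    rw [if_pos hb.2] at hd
    refine (runs_augment hI hn hm.le h₁ hb.1).mono ?_
    rintro σ₂ (⟨h₂, h14⟩ | ⟨h₂, h14⟩)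
    · exact ⟨d - 1, by omega, j, h₂, by rw [if_neg h14]; omega⟩
    · have := h₂.opt.value_le hI.source_ne
      exact ⟨d - 1, by omega, j + 1, h₂, by rw [if_pos h14]; omega⟩
  · rintro d σ₁ ⟨j, h₁, -⟩ hb
    simp only [Test.holds, holds_natEq, NatExp.eval, eval_cell, h₁.input.nat_zero, h₁.value,
      not_le, not_and] at hb
    refine Runs.branch (fun hc => Runs.setCell ?_) (fun hc => Runs.skip ?_) <;>
      simp only [Test.holds, NatExp.eval, eval_cell, h₁.input.nat_zero, h₁.value, not_le] at hc
    · refine ⟨j, h₁.value_le, ?_, fun _ => le_antisymm h₁.value_le hc, fun h4 => ?_⟩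
      · simpa [Store.setNat_nat, Store.setNat_real] using h₁.opt
      · simp [Store.setNat_nat, NatExp.eval] at h4
    · exact ⟨j, h₁.value_le, h₁.opt, fun h4 => absurd h₁.input.nat_four h4,
        fun _ => ⟨hc, h₁.fail (hb hc)⟩⟩

/-- The edges that carry flow. -/
def suppEdges {ι V : Type*} [Fintype ι] [DecidableEq V] (a b : ι → V) (y : ι → ℤ) :
    Finset (Sym2 V) :=
  (Finset.univ.filter fun i => y i ≠ 0).image fun i => s(a i, b i)

/-! ### Edge lists, feasible sets and flows. -/

section EdgeList

variable {V : Type*} {G : SimpleGraph V} {l : List (V × V)}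

lemma IsEdgeList.injective (hl : IsEdgeList G l) :
    Function.Injective fun i : Fin l.length => s((l.get i).1, (l.get i).2) := by
  intro i j h
  have h1 := List.nodup_iff_injective_get.1 hl.1
  have h2 : (l.map fun x => s(x.1, x.2)).get ⟨i, by simp⟩ =
      (l.map fun x => s(x.1, x.2)).get ⟨j, by simp⟩ := by simpa using h
  simpa [Fin.ext_iff] using h1 h2

lemma IsEdgeList.mem_edgeSet (hl : IsEdgeList G l) (i : Fin l.length) :
    s((l.get i).1, (l.get i).2) ∈ G.edgeSet :=
  (hl.2 _).2 (List.mem_map.2 ⟨l.get i, l.get_mem i, rfl⟩)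

lemma IsEdgeList.exists_of_mem (hl : IsEdgeList G l) {e : Sym2 V} (he : e ∈ G.edgeSet) :
    ∃ i : Fin l.length, s((l.get i).1, (l.get i).2) = e := by
  obtain ⟨x, hx, rfl⟩ := List.mem_map.1 ((hl.2 e).1 he)
  obtain ⟨i, rfl⟩ := List.get_of_mem hx
  exact ⟨i, rfl⟩

/-- Makes `(V, F)` an admissible input of the algorithm; no edge of `F` is lost as a loop, since `F`
lies in `G`. -/
lemma exists_isEdgeList (F : Finset (Sym2 V)) (hF : (F : Set (Sym2 V)) ⊆ G.edgeSet) :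
    ∃ l, IsEdgeList (SimpleGraph.fromEdgeSet (F : Set (Sym2 V))) l := by
  have h : (F.toList.map Quot.out).map (fun x : V × V => s(x.1, x.2)) = F.toList := by
    rw [List.map_map]
    convert List.map_id _
    funext e
    exact Quot.out_eq e
  refine ⟨F.toList.map Quot.out, by rw [h]; exact F.nodup_toList, fun e => ?_⟩
  rw [h, SimpleGraph.edgeSet_fromEdgeSet, Finset.mem_toList]
  exact ⟨fun h => h.1, fun h => ⟨h, G.not_isDiag_of_mem_edgeSet (hF h)⟩⟩

lemma Feasible.exists_isFlow [DecidableEq V] (hl : IsEdgeList G l) {s t : V} {k : ℕ}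
    {F : Finset (Sym2 V)} (hF : Feasible G s t k F) :
    ∃ y : Fin l.length → ℤ, IsFlow (fun i => (l.get i).1) (fun i => (l.get i).2) s t k y ∧
      suppEdges (fun i => (l.get i).1) (fun i => (l.get i).2) y ⊆ F := by
  have hH : ∀ e ∈ (SimpleGraph.fromEdgeSet (F : Set (Sym2 V))).edgeSet, e ∈ F := by
    intro e he
    rw [SimpleGraph.edgeSet_fromEdgeSet] at he
    exact he.1
  obtain ⟨y, hy, hys⟩ := hF.2.exists_isFlow hl.injective fun e he =>
    hl.exists_of_mem (hF.1 (hH e he))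
  refine ⟨y, hy, fun e he => ?_⟩
  obtain ⟨i, hi, rfl⟩ := Finset.mem_image.1 he
  exact hH _ (hys i (Finset.mem_filter.1 hi).2)

lemma IsFlow.feasible [DecidableEq V] [Fintype V] (hl : IsEdgeList G l) {s t : V} {k : ℕ}
    {y : Fin l.length → ℤ}
    (hy : IsFlow (fun i => (l.get i).1) (fun i => (l.get i).2) s t k y) :
    Feasible G s t k (suppEdges (fun i => (l.get i).1) (fun i => (l.get i).2) y) := by
  refine ⟨fun e he => ?_, ?_⟩
  · obtain ⟨i, -, rfl⟩ := Finset.mem_image.1 he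
    exact hl.mem_edgeSet i
  · obtain ⟨p, hp, -⟩ := hy.exists_paths hl.injective
      (H := SimpleGraph.fromEdgeSet (suppEdges (fun i => (l.get i).1) (fun i => (l.get i).2) y :
        Set (Sym2 V))) (fun i hi => by
        rw [SimpleGraph.fromEdgeSet_adj]
        refine ⟨Finset.mem_image.2 ⟨i, by simp [hi], rfl⟩, ?_⟩
        exact G.ne_of_adj (hl.mem_edgeSet i))
    exact ⟨p, hp⟩

lemma sum_suppEdges [DecidableEq V] (hl : IsEdgeList G l) (c : Sym2 V → ℝ≥0)
    {y : Fin l.length → ℤ} (hy : ∀ i, |y i| ≤ 1) :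
    ((∑ e ∈ suppEdges (fun i => (l.get i).1) (fun i => (l.get i).2) y, c e : ℝ≥0) : ℝ) =
      ∑ i, (c s((l.get i).1, (l.get i).2) : ℝ) * |(y i : ℝ)| := by
  rw [suppEdges, Finset.sum_image fun i _ j _ h => hl.injective h, Finset.sum_filter,
    NNReal.coe_sum]
  refine Finset.sum_congr rfl fun i _ => ?_
  have h1 := abs_le.1 (hy i)
  have h2 : y i = 0 ∨ y i = 1 ∨ y i = -1 := by omega
  rcases h2 with h | h | h <;> simp [h]

end EdgeList

/-! ### Correctness of the algorithm and existence of potentials. -/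

section Correctness

variable {n : ℕ} {G : SimpleGraph (Fin n)} {l : List (Fin n × Fin n)} {s t : Fin n} {k : ℕ}

/-- An unused edge has two residual arcs, which give the two-sided bound; a used edge has only its
reverse arc, of cost `-C`, which gives the lower bound on the potential difference. -/
lemma OptFlow.slack {a b : Fin l.length → Fin n} {A B x : ℕ → ℕ} {C π : ℕ → ℝ} {g : ℕ → ℤ}
    {c : Fin l.length → ℝ} (ha : ∀ i : Fin l.length, A i = a i)
    (hb : ∀ i : Fin l.length, B i = b i) (hc : ∀ i : Fin l.length, C i = c i)
    (h : OptFlow l.length A B C x π g) :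
    Slack a b c (fun i => flowOfState (x i)) (fun v => π v) := by
  intro i
  have h1 := h.le_two i i.2
  have h2 := h.redCost_nonneg i i.2 true
  have h3 := h.redCost_nonneg i i.2 false
  simp only [redCost, tail, ha, hb, hc, Bool.not_true, Bool.not_false, cond_true, cond_false,
    dirCode] at h2 h3
  rw [abs_le]
  have hx : x i = 0 ∨ x i = 1 ∨ x i = 2 := by omega
  rcases hx with hx | hx | hx <;> simp [flowOfState, hx] at h2 h3 ⊢
  · constructor <;> linarith
  · linarith
  · linarith

lemma OptFlow.isFlow {a b : Fin l.length → Fin n} {A B x : ℕ → ℕ} {C π : ℕ → ℝ} {j : ℕ}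
    (ha : ∀ i : Fin l.length, A i = a i) (hb : ∀ i : Fin l.length, B i = b i)
    (h : OptFlow l.length A B C x π (demand s t j)) :
    IsFlow a b s t j (fun i => flowOfState (x i)) := by
  refine ⟨fun i => ?_, fun v => ?_⟩
  · unfold flowOfState
    split_ifs <;> simp
  · have := h.netOut_eq v
    simpa only [netOut, ha, hb, demand, Fin.val_inj] using this

/-- What the algorithm computes if the two terminals are different. -/
lemma minCostProgram_flow (hl : IsEdgeList G l) (c : Sym2 (Fin n) → ℝ≥0) (hst : s ≠ t) (k : ℕ) :
    ∃ τ σ, Exec minCostProgram (inputStore l c s t k) τ σ ∧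
      τ ≤ minCostProgram.timePoly.eval (n + l.length) ∧
      ∃ (y : Fin l.length → ℤ) (π : Fin n → ℝ) (j : ℕ),
        IsFlow (fun i => (l.get i).1) (fun i => (l.get i).2) s t j y ∧
        Slack (fun i => (l.get i).1) (fun i => (l.get i).2)
          (fun i => (c s((l.get i).1, (l.get i).2) : ℝ)) y π ∧
        outputEdges l σ = suppEdges (fun i => (l.get i).1) (fun i => (l.get i).2) y ∧
        (ReportsSolution σ → j = k) ∧
        (¬ ReportsSolution σ → ¬ ∃ F, Feasible G s t k F) := by
  set σ₀ := inputStore l c s t k with hσ₀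
  have hA : ∀ i : Fin l.length, σ₀.nat 1 i = ((l.get i).1 : ℕ) := by
    intro i; simp [hσ₀, inputStore]
  have hB : ∀ i : Fin l.length, σ₀.nat 2 i = ((l.get i).2 : ℕ) := by
    intro i; simp [hσ₀, inputStore]
  have hC : ∀ i : Fin l.length, σ₀.real 0 i = (c s((l.get i).1, (l.get i).2) : ℝ) := by
    intro i; simp [hσ₀, inputStore]
  have h0 : σ₀.nat 0 0 = n := rfl
  have h1 : σ₀.nat 0 1 = l.length := rfl
  have h2 : σ₀.nat 0 2 = s := rfl
  have h3 : σ₀.nat 0 3 = t := rfl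
  have h4 : σ₀.nat 0 4 = k := rfl
  have hinput : IsInput (σ₀.nat 0) (σ₀.nat 1) (σ₀.nat 2) (σ₀.real 0) := by
    refine ⟨fun i hi => ?_, fun i hi => ?_, fun i hi => ?_, s.2, t.2, ?_⟩
    · exact (hA ⟨i, hi⟩).trans_lt (Fin.is_lt _)
    · exact (hB ⟨i, hi⟩).trans_lt (Fin.is_lt _)
    · rw [hC ⟨i, hi⟩]
      exact NNReal.coe_nonneg _
    · rw [h2, h3]
      exact fun h => hst (Fin.ext h)
  have hflow : FlowInv (σ₀.nat 0) (σ₀.nat 1) (σ₀.nat 2) (σ₀.real 0) 0 σ₀ := by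
    refine ⟨⟨rfl, rfl, rfl, rfl, rfl⟩, rfl, ⟨fun _ _ => Nat.zero_le _, fun i hi o _ => ?_,
      fun v => ?_⟩, fun _ => le_rfl, Nat.zero_le _, fun h => absurd rfl h⟩
    · have : redCost (σ₀.nat 1) (σ₀.nat 2) (σ₀.real 0) (σ₀.nat 3) (σ₀.real 1) i o =
          σ₀.real 0 i := by
        simp [redCost, hσ₀, inputStore]
      rw [this]
      exact hinput.cost_nonneg i hi
    · have : ∀ i, flowOfState (σ₀.nat 3 i) = 0 := fun _ => rfl
      simp [netOut, this, demand]
  obtain ⟨τ, σ, hex, hτ, j, -, hopt, hrep, hno⟩ := runs_minCostProgram (N := n + l.length) hinput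
    (Nat.le_add_right _ _) (show l.length < _ from Nat.lt_add_of_pos_left s.pos) hflow
  have hopt' : OptFlow l.length (σ₀.nat 1) (σ₀.nat 2) (σ₀.real 0) (σ.nat 3) (σ.real 1)
    (demand s t j) := hopt
  have hy := hopt'.isFlow hA hB
  refine ⟨τ, σ, hex, hτ, _, _, j, hy, hopt'.slack hA hB hC, ?_, hrep, fun hr => ?_⟩
  · have : ∀ x, flowOfState x ≠ 0 ↔ x ≠ 0 := by
      intro x
      unfold flowOfState
      split_ifs <;> simp_all
    simp only [outputEdges, suppEdges, this]
  · rintro ⟨F, hF⟩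
    -- A blocked set is a cut saturated by the computed flow, so its value `j < k` is the maximum
    -- and no flow of value `k` exists.
    obtain ⟨hj, S, hS, hS', hSr⟩ := hno (not_not.1 hr)
    obtain ⟨z, hz, -⟩ := hF.exists_isFlow hl
    have := hy.le_of_cut hz (fun v => S v) hS hS' (fun i h5 h6 => ?_) (fun i h5 h6 => ?_)
    · have : j < k := hj
      omega
    · have h7 := hSr i i.2 true
      simp only [tail, hA, hB, cond_true, cond_false, Bool.not_true, dirCode] at h7
      have : σ.nat 3 i = 1 := by
        by_contra h8
        exact h6 (h7 h8 h5)
      simp [flowOfState, this]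
    · have h7 := hSr i i.2 false
      simp only [tail, hA, hB, cond_true, cond_false, Bool.not_false, dirCode] at h7
      have : σ.nat 3 i = 2 := by
        by_contra h8
        exact h6 (h7 h8 h5)
      simp [flowOfState, this]

/-- The algorithm finds a solution of minimum cost. -/
lemma minCostProgram_spec (hl : IsEdgeList G l) (c : Sym2 (Fin n) → ℝ≥0) (s t : Fin n) (k : ℕ) :
    ∃ τ σ, Exec minCostProgram (inputStore l c s t k) τ σ ∧
      τ ≤ minCostProgram.timePoly.eval (n + l.length) ∧
      (ReportsSolution σ ↔ ∃ F, Feasible G s t k F) ∧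
      (ReportsSolution σ → Feasible G s t k (outputEdges l σ) ∧
        ∀ F, Feasible G s t k F → ∑ e ∈ outputEdges l σ, c e ≤ ∑ e ∈ F, c e) := by
  by_cases hst : s = t
  · subst hst
    have hrun : Runs (n + l.length) minCostProgram (inputStore l c s s k) fun σ =>
        σ = (inputStore l c s s k).setNat 4 0 1 :=
      Runs.branch (fun _ => Runs.setCell rfl) fun h => absurd (holds_natEq.2 rfl) h
    obtain ⟨τ, σ, hex, hτ, rfl⟩ := hrun
    have hrep : ReportsSolution ((inputStore l c s s k).setNat 4 0 1) := by
      simp [ReportsSolution, Store.setNat_nat]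
    have hout : outputEdges l ((inputStore l c s s k).setNat 4 0 1) = ∅ := by
      simp [outputEdges, Store.setNat_nat, inputStore]
    have hfeas : Feasible G s s k ∅ :=
      ⟨by simp, fun _ => ⟨.nil, by simp⟩, fun _ _ _ => by simp⟩
    refine ⟨τ, _, hex, hτ, ⟨fun _ => ⟨∅, hfeas⟩, fun _ => hrep⟩, fun _ => ?_⟩
    rw [hout]
    exact ⟨hfeas, by simp⟩
  · obtain ⟨τ, σ, hex, hτ, y, π, j, hy, hslack, hout, hrep, hno⟩ :=
      minCostProgram_flow hl c hst k
    refine ⟨τ, σ, hex, hτ, ⟨fun h => ?_, fun h => by_contra fun h' => hno h' h⟩, fun h => ?_⟩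
    · rw [hrep h] at hy
      exact ⟨_, hy.feasible hl⟩
    · rw [hrep h] at hy
      rw [hout]
      refine ⟨hy.feasible hl, fun F hF => ?_⟩
      obtain ⟨z, hz, hzF⟩ := hF.exists_isFlow hl
      refine le_trans ?_ (Finset.sum_le_sum_of_subset hzF)
      rw [← NNReal.coe_le_coe, sum_suppEdges hl c hy.abs_le, sum_suppEdges hl c hz.abs_le]
      exact hy.cost_le (fun i => NNReal.coe_nonneg _) hslack hz

/-- Every feasible solution contains the support of a flow that goes up along some potential. -/
lemma Feasible.exists_monotone_flow {F : Finset (Sym2 (Fin n))} (hst : s ≠ t)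
    (hF : Feasible G s t k F) :
    ∃ l, IsEdgeList (SimpleGraph.fromEdgeSet (F : Set (Sym2 (Fin n)))) l ∧
      ∃ (y : Fin l.length → ℤ) (π : Fin n → ℝ),
        IsFlow (fun i => (l.get i).1) (fun i => (l.get i).2) s t k y ∧
        Slack (fun i => (l.get i).1) (fun i => (l.get i).2) (fun _ => 1) y π := by
  obtain ⟨l, hl⟩ := exists_isEdgeList F hF.1
  refine ⟨l, hl, ?_⟩
  -- The algorithm itself is run on `(V, F)` with unit costs; it cannot report failure, since `F` is
  -- feasible there.
  obtain ⟨-, σ, -, -, y, π, j, hy, hslack, -, hrep, hno⟩ :=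
    minCostProgram_flow hl (fun _ => 1) hst k
  have : ReportsSolution σ := by
    by_contra h
    refine hno h ⟨F, fun e he => ?_, hF.2⟩
    rw [SimpleGraph.edgeSet_fromEdgeSet]
    exact ⟨he, G.not_isDiag_of_mem_edgeSet (hF.1 he)⟩
  rw [hrep this] at hy
  exact ⟨y, π, hy, by simpa using hslack⟩

end Correctness

/-! ### Cost versus power. -/

section Power

variable {V : Type*} [Fintype V] [DecidableEq V]

/-- The maximum at a node is at most the sum of the incident costs, and every edge is incident to at
most two nodes. -/
lemma power_le_two_mul_sum (c : Sym2 V → ℝ≥0) (F : Finset (Sym2 V)) :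
    power c F ≤ 2 * ∑ e ∈ F, c e := by
  calc power c F ≤ ∑ v : V, ∑ e ∈ F.filter (fun e => v ∈ e), c e := by
        refine Finset.sum_le_sum fun v _ => Finset.sup_le fun e he => ?_
        exact Finset.single_le_sum (f := c) (fun _ _ => zero_le) he
    _ = ∑ e ∈ F, ∑ v : V, if v ∈ e then c e else 0 := by
        simp only [Finset.sum_filter]
        exact Finset.sum_comm
    _ ≤ ∑ e ∈ F, 2 * c e := by
        refine Finset.sum_le_sum fun e _ => ?_
        rw [← Finset.sum_filter, Finset.sum_const, nsmul_eq_mul]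
        gcongr
        induction e with
        | _ x y =>
          have : (Finset.univ.filter fun v => v ∈ s(x, y)) ⊆ {x, y} := by
            intro v hv
            simpa using hv
          exact_mod_cast (Finset.card_le_card this).trans Finset.card_le_two
    _ = 2 * ∑ e ∈ F, c e := by rw [Finset.mul_sum]

/-- The cost of a flow of value `k` that goes up along a potential is at most `√(2k)` times the
power of any edge set that contains its support. -/
lemma IsFlow.sum_le_sqrt_mul_power {ι : Type*} [Fintype ι] {a b : ι → V}
    (hinj : Function.Injective fun i => s(a i, b i)) {s t : V} {k : ℕ} {y : ι → ℤ} {π : V → ℝ}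
    (hy : IsFlow a b s t k y) (hπ : Slack a b (fun _ => 1) y π) (c : Sym2 V → ℝ≥0)
    {F : Finset (Sym2 V)} (hF : suppEdges a b y ⊆ F) :
    ((∑ e ∈ suppEdges a b y, c e : ℝ≥0) : ℝ) ≤ √(2 * k) * power c F := by
  classical
  set D : Finset ι := Finset.univ.filter fun i => y i ≠ 0 with hD
  -- From here each edge of the support is oriented along the flow, from `u i` to `w i`.
  set u : ι → V := fun i => if y i = 1 then a i else b i with hu
  set w : ι → V := fun i => if y i = 1 then b i else a i with hw
  set p : V → ℝ≥0 := fun v => (F.filter fun e => v ∈ e).sup c with hp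
  have hmemD : ∀ i ∈ D, y i = 1 ∨ y i = -1 := by
    intro i hi
    exact (hy.cases i).resolve_left (Finset.mem_filter.1 hi).2
  have hedge : ∀ i, s(a i, b i) = s(u i, w i) := by
    intro i
    by_cases h : y i = 1 <;> simp [hu, hw, h, Sym2.eq_swap]
  have hup : ∀ i ∈ D, π (u i) < π (w i) := by
    intro i hi
    obtain ⟨-, h1, h2⟩ := hπ i
    rcases hmemD i hi with h | h
    · have := h1 h
      simp only [hu, hw, h, if_true]
      linarith
    · have := h2 h
      have h' : y i ≠ 1 := by omega
      simp only [hu, hw, h', if_false]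
      linarith
  -- All arcs go up, so nothing cancels: the number of crossings of level `r` is the net flow out of
  -- `{v | π v < r}`, which is at most `k`.
  have hcross : ∀ r, (D.filter fun i => π (u i) < r ∧ r ≤ π (w i)).card ≤ k := by
    intro r
    have h1 := hy.sum_eq (R := ℤ) fun v => if π v < r then 1 else 0
    have h2 : ((D.filter fun i => π (u i) < r ∧ r ≤ π (w i)).card : ℤ) =
        ∑ i, (y i : ℤ) * ((if π (a i) < r then 1 else 0) - if π (b i) < r then 1 else 0) := by
      rw [Finset.card_filter, Nat.cast_sum, hD, Finset.sum_filter]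
      refine Finset.sum_congr rfl fun i _ => ?_
      by_cases h0 : y i = 0
      · simp [h0]
      rw [if_pos h0]
      have hlt := hup i (by simp [hD, h0])
      have h3 : ((if π (u i) < r ∧ r ≤ π (w i) then 1 else 0 : ℕ) : ℤ) =
          (if π (u i) < r then 1 else 0) - if π (w i) < r then 1 else 0 := by
        by_cases h4 : π (u i) < r <;> by_cases h5 : π (w i) < r
        · simp [h4, h5]
        · simp [h4, h5, not_lt.1 h5]
        · exact absurd (hlt.trans h5) h4
        · simp [h4, h5]
      rw [h3]
      rcases hmemD i (by simp [hD, h0]) with h | h <;> simp [hu, hw, h]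
    simp only [Int.cast_id] at h1
    rw [h1] at h2
    have h3 : (k : ℤ) * ((if π s < r then 1 else 0) - if π t < r then 1 else 0) ≤ k * 1 := by
      gcongr
      split_ifs <;> simp
    omega
  have hdens : ∀ U : Finset V, ((D.filter fun i => u i ∈ U ∧ w i ∈ U).card : ℝ) ≤
      √(2 * k) * U.card := by
    intro U
    have h1 := card_sq_le_of_crossing_le (D.filter fun i => u i ∈ U ∧ w i ∈ U) u w π k U
      (fun i hi => (Finset.mem_filter.1 hi).2)
      (fun i _ j _ h2 h3 => hinj (by simp only [hedge, h2, h3]))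
      (fun i hi => hup i (Finset.mem_filter.1 hi).1)
      (fun r => (Finset.card_le_card (Finset.filter_subset_filter _
        (Finset.filter_subset _ _))).trans (hcross r))
    refine le_of_sq_le_sq ?_ (by positivity)
    rw [mul_pow, Real.sq_sqrt (by positivity)]
    exact_mod_cast h1
  -- The edge lies in `F`, so its cost is one of the values in the maximum defining `p` at either
  -- end.
  have hle : ∀ i ∈ D, (c s(a i, b i) : ℝ) ≤ min (p (u i) : ℝ) (p (w i)) := by
    intro i hi
    have hiF : s(a i, b i) ∈ F := hF (Finset.mem_image.2 ⟨i, hi, rfl⟩)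
    refine le_min ?_ ?_ <;> rw [NNReal.coe_le_coe] <;>
      refine Finset.le_sup (f := c) (Finset.mem_filter.2 ⟨hiF, ?_⟩) <;> rw [hedge] <;> simp
  have hmain := sum_min_le_of_card_le D u w (√(2 * k)) hdens (fun v => (p v : ℝ))
    fun v => NNReal.coe_nonneg _
  rw [suppEdges, Finset.sum_image fun i _ j _ h => hinj h, NNReal.coe_sum, power, NNReal.coe_sum]
  exact (Finset.sum_le_sum hle).trans hmain

end Power

/-- Every feasible solution contains one whose cost is at most `√(2k)` times the power of the
given solution. -/
lemma Feasible.exists_sum_le_sqrt_mul_power {n : ℕ} {G : SimpleGraph (Fin n)} {s t : Fin n}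
    {k : ℕ} {F : Finset (Sym2 (Fin n))} (hF : Feasible G s t k F) (c : Sym2 (Fin n) → ℝ≥0) :
    ∃ F', Feasible G s t k F' ∧ ((∑ e ∈ F', c e : ℝ≥0) : ℝ) ≤ √(2 * k) * power c F := by
  by_cases hst : s = t
  · subst hst
    refine ⟨∅, ⟨by simp, fun _ => ⟨.nil, by simp⟩, fun _ _ _ => by simp⟩, ?_⟩
    simp only [Finset.sum_empty, NNReal.coe_zero]
    positivity
  · obtain ⟨l, hl, y, π, hy, hπ⟩ := hF.exists_monotone_flow hst
    have hfeas := hy.feasible hl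
    have hsub : suppEdges (fun i => (l.get i).1) (fun i => (l.get i).2) y ⊆ F := by
      intro e he
      have := hfeas.1 he
      rw [SimpleGraph.edgeSet_fromEdgeSet] at this
      exact this.1
    exact ⟨_, ⟨fun e he => hF.1 (hsub he), hfeas.2⟩,
      hy.sum_le_sqrt_mul_power hl.injective hπ c hsub⟩

end MinPower

theorem theorem1 :
    ∃ (P : RAM.Program) (q : Polynomial ℕ),
      ∀ (n : ℕ) (G : SimpleGraph (Fin n)) (c : Sym2 (Fin n) → ℝ≥0) (s t : Fin n) (k : ℕ)
        (l : List (Fin n × Fin n)), 0 < k → MinPower.IsEdgeList G l →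
        ∃ (τ : ℕ) (σ : RAM.Store),
          RAM.Exec P (MinPower.inputStore l c s t k) τ σ ∧
          τ ≤ q.eval (n + l.length) ∧
          (MinPower.ReportsSolution σ ↔ ∃ F, MinPower.Feasible G s t k F) ∧
          (MinPower.ReportsSolution σ →
            MinPower.Feasible G s t k (MinPower.outputEdges l σ) ∧
            ∀ F, MinPower.Feasible G s t k F →
              ∑ e ∈ MinPower.outputEdges l σ, c e ≤ ∑ e ∈ F, c e ∧
              (MinPower.power c (MinPower.outputEdges l σ) : ℝ) ≤
                2 * √(2 * (k : ℝ)) * (MinPower.power c F : ℝ)) := by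
  refine ⟨MinPower.minCostProgram, MinPower.minCostProgram.timePoly,
    fun n G c s t k l _ hl => ?_⟩
  obtain ⟨τ, σ, hex, hτ, hiff, hrep⟩ := MinPower.minCostProgram_spec hl c s t k
  refine ⟨τ, σ, hex, hτ, hiff, fun hr => ⟨(hrep hr).1, fun F hF => ⟨(hrep hr).2 F hF, ?_⟩⟩⟩
  -- The bound is the chain `p(output) ≤ 2 c(output) ≤ 2 c(F') ≤ 2√(2k) p(F)`.
  obtain ⟨F', hF', hle⟩ := hF.exists_sum_le_sqrt_mul_power c
  have h1 : (MinPower.power c (MinPower.outputEdges l σ) : ℝ) ≤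
      2 * ((∑ e ∈ MinPower.outputEdges l σ, c e : ℝ≥0) : ℝ) := by
    exact_mod_cast MinPower.power_le_two_mul_sum c (MinPower.outputEdges l σ)
  have h2 : ((∑ e ∈ MinPower.outputEdges l σ, c e : ℝ≥0) : ℝ) ≤ (∑ e ∈ F', c e : ℝ≥0) :=
    NNReal.coe_le_coe.2 ((hrep hr).2 F' hF')
  linarith

end
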